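/- For $k\ge 1$ and $0\le e\le k$ let $D_{2k}^e$ be the set of lattice paths that start at $(0,0)$, consist of $k$ up-steps $(1,1)$ and $k$ down-steps $(1,-1)$, and have exactly $e$ down-steps below the line $y=0$. For a lattice path $x$ let $d_0(x)$ be the number of down-steps of $x$ starting on the line $y=0$, and let $u_1(x)$ be the number of up-steps of $x$ starting on the line $y=1$; a step touches a line if it starts or ends on it. Let $g(x)$ be obtained from $x$ by flipping the $(d_0(x)+1)$-th down-step of $x$ touching the line $y=0$, let $h(x')$ be obtained from $x'$ by flipping the $u_1(x')$-th up-step of $x'$ touching the line $y=1$, and let $f(x):=h(g(x))$, which maps $D_{2k}^e$ to $D_{2k}^{e+1}$ for $e<k$. Theorem 3. There is an algorithm that, given any $k\ge 1$, $e\in\{0,1,\ldots,k-1\}$ and $x\in D_{2k}^e$, generates the Dyck paths $f(x)\in D_{2k}^{e+1}$, $f^2(x)\in D_{2k}^{e+2}$, $\ldots$, $f^{k-e}(x)\in D_{2k}^{k}$ one after the other in this order. After an initialization that takes time $\mathcal{O}(k)$, each of these paths is computed in time $\mathcal{O}(1)$. The algorithm uses space $\mathcal{O}(k)$, and its overall running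 time including the initialization is $\mathcal{O}(k)$. Here the algorithm is one fixed program for a unit-cost random access machine whose words hold integers between $0$ and $\mathcal{O}(k)$ (i.e. have $\log_2 k+\mathcal{O}(1)$ bits), the current path is stored in an array of $2k$ memory cells that initially contains $x$ and that at the $i$-th output contains $f^i(x)$, and all $\mathcal{O}$-constants are absolute. -/

import Mathlib

namespace ChungFeller

/-! ### Lattice paths and the mapping `f`

A lattice path starting at the origin is the list of its steps: `true` is an up-step `(1,1)` and
`false` is a down-step `(1,-1)`. Positions of steps are counted from `0`. -/

/-- The change of the second coordinate caused by a step. -/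
def rise (b : Bool) : ℤ := if b then 1 else -1

/-- The height of the path `x` after its first `i` steps; the step at position `i` starts at height
`height x i` and ends at height `height x (i + 1)`. -/
def height (x : List Bool) (i : ℕ) : ℤ := ((x.take i).map rise).sum

/-- The number of down-steps of `x` below the line `y = 0`, i.e. starting at height at most `0`. -/
def flaws (x : List Bool) : ℕ :=
  ((List.range x.length).filter fun i => x[i]? = some false ∧ height x i ≤ 0).length

/-- The set `D_{2k}^e` of Dyck paths with `2k` steps and `e` flaws. -/
def D (k e : ℕ) : Set (List Bool) :=
  {x | x.length = 2 * k ∧ x.count true = k ∧ flaws x = e}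

/-- `u_c(x)`: the number of up-steps of `x` starting on the line `y = c`. -/
def u (c : ℤ) (x : List Bool) : ℕ :=
  ((List.range x.length).filter fun i => x[i]? = some true ∧ height x i = c).length

/-- `d_c(x)`: the number of down-steps of `x` starting on the line `y = c`. -/
def d (c : ℤ) (x : List Bool) : ℕ :=
  ((List.range x.length).filter fun i => x[i]? = some false ∧ height x i = c).length

/-- The positions, from left to right, of the steps of `x` of kind `b` that touch the line `y = c`,
i.e. that start or end on it. -/
def touching (b : Bool) (c : ℤ) (x : List Bool) : List ℕ :=
  (List.range x.length).filter fun i => x[i]? = some b ∧ (height x i = c ∨ height x (i + 1) = c)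

/-- Flip the step of `x` at the given position, if there is one. -/
def flip (x : List Bool) : Option ℕ → List Bool
  | none => x
  | some i => x.modify i not

/-- `g` flips the `(d_0(x)+1)`-th down-step touching the line `y = 0`
(entry number `d_0(x)`, counting from `0`). -/
def g (x : List Bool) : List Bool := flip x (touching false 0 x)[d 0 x]?

/-- `h` flips the `u_1(x)`-th up-step touching the line `y = 1`
(entry number `u_1(x) - 1`, counting from `0`). -/
def h (x : List Bool) : List Bool :=
  if u 1 x = 0 then x else flip x (touching true 1 x)[u 1 x - 1]?

/-- The minimum-change mapping `f = h ∘ g`. -/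
def f (x : List Bool) : List Bool := h (g x)

/-! ### Random access machines

The machine has registers and a memory whose cells are addressed by natural numbers; every register
and every cell holds one natural number. A program is a fixed finite list of instructions (so it
uses only finitely many registers), and executing one instruction takes one unit of time. -/

/-- Instructions; `r`, `s`, `t` are (names of) registers and `l` is a position in the program. -/
inductive Instr where
  /-- `r := n` -/
  | const (r n : ℕ)
  /-- `r := s` -/
  | move (r s : ℕ)
  /-- `r := s + t` -/
  | add (r s t : ℕ)
  /-- `r := max (s - t) 0` -/
  | sub (r s t : ℕ)
  /-- `r :=` content of the memory cell whose address is in `s` -/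
  | load (r s : ℕ)
  /-- the memory cell whose address is in `r` receives the content of `s` -/
  | store (r s : ℕ)
  /-- go to `l` -/
  | jump (l : ℕ)
  /-- if `r < s` then go to `l` -/
  | jumpLt (r s l : ℕ)
  /-- if `r = s` then go to `l` -/
  | jumpEq (r s l : ℕ)
  /-- announce that the memory now holds the next object to be generated -/
  | emit

/-- A program. -/
abbrev Program := List Instr

/-- A configuration: program counter, contents of the registers, contents of the memory. -/
structure Config where
  pc : ℕ
  reg : ℕ → ℕ
  mem : ℕ → ℕ

/-- The effect of one instruction. -/
def Instr.exec (c : Config) : Instr → Config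
  | .const r n => ⟨c.pc + 1, Function.update c.reg r n, c.mem⟩
  | .move r s => ⟨c.pc + 1, Function.update c.reg r (c.reg s), c.mem⟩
  | .add r s t => ⟨c.pc + 1, Function.update c.reg r (c.reg s + c.reg t), c.mem⟩
  | .sub r s t => ⟨c.pc + 1, Function.update c.reg r (c.reg s - c.reg t), c.mem⟩
  | .load r s => ⟨c.pc + 1, Function.update c.reg r (c.mem (c.reg s)), c.mem⟩
  | .store r s => ⟨c.pc + 1, c.reg, Function.update c.mem (c.reg r) (c.reg s)⟩
  | .jump l => ⟨l, c.reg, c.mem⟩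
  | .jumpLt r s l => ⟨if c.reg r < c.reg s then l else c.pc + 1, c.reg, c.mem⟩
  | .jumpEq r s l => ⟨if c.reg r = c.reg s then l else c.pc + 1, c.reg, c.mem⟩
  | .emit => ⟨c.pc + 1, c.reg, c.mem⟩

/-- The memory address that an instruction reads or writes, if any. -/
def Instr.address (c : Config) : Instr → Option ℕ
  | .load _ s => some (c.reg s)
  | .store r _ => some (c.reg r)
  | _ => none

/-- One step of the machine; it stands still once the program counter has left the program. -/
def step (P : Program) (c : Config) : Config :=
  match P[c.pc]? with
  | none => c
  | some i => i.exec c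

/-- The configuration at time `t`, starting from `c`. -/
def run (P : Program) (c : Config) (t : ℕ) : Config := (step P)^[t] c

/-- The machine has halted. -/
def Halted (P : Program) (c : Config) : Prop := P.length ≤ c.pc

/-- The machine is executing an `emit` instruction. -/
def Emits (P : Program) (c : Config) : Prop := P[c.pc]? = some Instr.emit

/-- The next step of the machine accesses no memory cell with address `S` or larger. -/
def AccessesBelow (P : Program) (S : ℕ) (c : Config) : Prop :=
  ∀ i ∈ P[c.pc]?, ∀ a ∈ i.address c, a < S

/-- All registers and all memory cells hold numbers at most `W`. -/
def WordsAtMost (W : ℕ) (c : Config) : Prop :=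
  (∀ r, c.reg r ≤ W) ∧ ∀ a, c.mem a ≤ W

/-- A path written into memory, one step per cell, from address `0` on:
`1` for an up-step, `0` for a down-step (and for the cells behind the path). -/
def cells (x : List Bool) (a : ℕ) : ℕ := if x[a]? = some true then 1 else 0

/-- The initial configuration on input `k`, `e`, `x`: the numbers `k` and `e` are in the registers
`0` and `1`, the path `x` is in memory, and everything else is `0`. -/
def input (k e : ℕ) (x : List Bool) : Config where
  pc := 0
  reg r := if r = 0 then k else if r = 1 then e else 0
  mem := cells x

end ChungFeller

/-! View a positive Dyck word as an ordered forest whose nodes are its arches. Inside a path `L A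
R`, with `L` and `R` of total height 0, the step flipped by `g` is the closing step of the first
arch of `A` exactly when `L` has as many down-steps from `y = 1` as `R` has from its own starting
line. The arch then has up-steps at both ends, and its interior starts on `y = 1`. There `h` plays
the mirror role: it flips the opening step of the last arch of the interior. The two balance
conditions, `CtxF` and `CtxG`, turn into each other whenever an arch is entered, and finished or
pending arches beside the current one do not disturb them.

Hence `f` performs a depth-first traversal, from left to right at one depth and from right to left
at the next (`walk_word`). Each arch costs one half-step to enter and one to leave, and it ends
upside down at the same place. Matched positions therefore never change, so a fixed partner array
and a cursor determine every half-step in constant time.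

A given path may lie in the middle of such a traversal. A negative first arch is finished and a
positive last arch is pending. A positive first arch together with a negative last arch are the two
ends of an unfinished arch: it has been entered by `g`, the part of its interior right of some inner
arch is done, and that inner arch has been entered by `h`. Peeling off arches in this way (`Layout`,
`walk_layout`) recovers the cursor and the partners. Each traversal step adds one flaw, so exactly
`k - e` steps remain. The program matches steps with a stack, rewires the unfinished arches, and
then runs the traversal. -/

namespace ChungFeller

/-! ### Counting steps of concatenations -/

/-- The total height change of a word. -/
def ht (x : List Bool) : ℤ := (x.map rise).sum

/-- The number of down-steps starting at height at most `c`. -/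
def fl (c : ℤ) (x : List Bool) : ℕ :=
  ((List.range x.length).filter fun i => x[i]? = some false ∧ height x i ≤ c).length

theorem flaws_eq_fl (x : List Bool) : flaws x = fl 0 x := rfl

@[simp] theorem rise_true : rise true = 1 := rfl
@[simp] theorem rise_false : rise false = -1 := rfl

theorem height_zero (x : List Bool) : height x 0 = 0 := by simp [height]

theorem height_cons_succ (b : Bool) (x : List Bool) (i : ℕ) :
    height (b :: x) (i + 1) = rise b + height x i := by simp [height]

@[simp] theorem ht_nil : ht [] = 0 := rfl
@[simp] theorem ht_cons (b : Bool) (x : List Bool) : ht (b :: x) = rise b + ht x := by simp [ht]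
@[simp] theorem ht_append (x y : List Bool) : ht (x ++ y) = ht x + ht y := by simp [ht]

theorem ht_add_length (x : List Bool) : ht x + x.length = 2 * x.count true := by
  induction x with
  | nil => simp
  | cons b x ih => cases b <;> simp <;> omega

theorem length_filter_range_succ (n : ℕ) (p : ℕ → Bool) :
    ((List.range (n + 1)).filter p).length =
      (if p 0 then 1 else 0) + ((List.range n).filter fun i => p (i + 1)).length := by
  rw [List.range_succ_eq_map, List.filter_cons, List.filter_map]
  split <;> simp [Function.comp_def, add_comm]

@[simp] theorem u_nil (c : ℤ) : u c [] = 0 := rfl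
@[simp] theorem d_nil (c : ℤ) : d c [] = 0 := rfl
@[simp] theorem fl_nil (c : ℤ) : fl c [] = 0 := rfl

theorem u_cons (c : ℤ) (b : Bool) (x : List Bool) :
    u c (b :: x) = (if b = true ∧ c = 0 then 1 else 0) + u (c - rise b) x := by
  simp only [u, List.length_cons, length_filter_range_succ, height_zero, height_cons_succ,
    List.getElem?_cons_zero, List.getElem?_cons_succ, decide_eq_true_eq, Option.some.injEq,
    eq_comm (a := (0 : ℤ)), eq_sub_iff_add_eq']

theorem d_cons (c : ℤ) (b : Bool) (x : List Bool) :
    d c (b :: x) = (if b = false ∧ c = 0 then 1 else 0) + d (c - rise b) x := by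
  simp only [d, List.length_cons, length_filter_range_succ, height_zero, height_cons_succ,
    List.getElem?_cons_zero, List.getElem?_cons_succ, decide_eq_true_eq, Option.some.injEq,
    eq_comm (a := (0 : ℤ)), eq_sub_iff_add_eq']

theorem fl_cons (c : ℤ) (b : Bool) (x : List Bool) :
    fl c (b :: x) = (if b = false ∧ 0 ≤ c then 1 else 0) + fl (c - rise b) x := by
  simp only [fl, List.length_cons, length_filter_range_succ, height_zero, height_cons_succ,
    List.getElem?_cons_zero, List.getElem?_cons_succ, decide_eq_true_eq, Option.some.injEq,
    le_sub_iff_add_le']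

@[simp] theorem u_cons_true (c : ℤ) (x : List Bool) :
    u c (true :: x) = (if c = 0 then 1 else 0) + u (c - 1) x := by simp [u_cons]
@[simp] theorem u_cons_false (c : ℤ) (x : List Bool) : u c (false :: x) = u (c + 1) x := by
  simp [u_cons]
@[simp] theorem d_cons_false (c : ℤ) (x : List Bool) :
    d c (false :: x) = (if c = 0 then 1 else 0) + d (c + 1) x := by simp [d_cons]
@[simp] theorem d_cons_true (c : ℤ) (x : List Bool) : d c (true :: x) = d (c - 1) x := by
  simp [d_cons]
@[simp] theorem fl_cons_false (c : ℤ) (x : List Bool) :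
    fl c (false :: x) = (if 0 ≤ c then 1 else 0) + fl (c + 1) x := by simp [fl_cons]
@[simp] theorem fl_cons_true (c : ℤ) (x : List Bool) : fl c (true :: x) = fl (c - 1) x := by
  simp [fl_cons]

@[simp] theorem u_append (c : ℤ) (x y : List Bool) : u c (x ++ y) = u c x + u (c - ht x) y := by
  induction x generalizing c with
  | nil => simp
  | cons b x ih => simp only [List.cons_append, u_cons, ih, ht_cons, sub_sub, add_assoc]

@[simp] theorem d_append (c : ℤ) (x y : List Bool) : d c (x ++ y) = d c x + d (c - ht x) y := by
  induction x generalizing c with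
  | nil => simp
  | cons b x ih => simp only [List.cons_append, d_cons, ih, ht_cons, sub_sub, add_assoc]

@[simp] theorem fl_append (c : ℤ) (x y : List Bool) :
    fl c (x ++ y) = fl c x + fl (c - ht x) y := by
  induction x generalizing c with
  | nil => simp
  | cons b x ih => simp only [List.cons_append, fl_cons, ih, ht_cons, sub_sub, add_assoc]

/-- The edge between the lines `y = c` and `y = c + 1` is crossed alternately in both directions. -/
theorem u_sub_d (c : ℤ) (x : List Bool) :
    (u c x : ℤ) - d (c + 1) x = (if c < ht x then 1 else 0) - (if c < 0 then 1 else 0) := by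
  induction x generalizing c with
  | nil => simp only [u_nil, d_nil, ht_nil]; omega
  | cons b x ih =>
    cases b
    · have := ih (c + 1)
      simp only [u_cons_false, d_cons_false, ht_cons, rise_false]
      push_cast
      split_ifs at * <;> omega
    · have := ih (c - 1)
      simp only [u_cons_true, d_cons_true, ht_cons, rise_true]
      rw [sub_add_cancel] at this
      rw [add_sub_cancel_right]
      push_cast
      split_ifs at * <;> omega

/-! ### The flipped steps -/

theorem height_append (a x : List Bool) (i : ℕ) :
    height (a ++ x) (a.length + i) = ht a + height x i := by
  simp [height, ht, List.take_append, List.take_of_length_le]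

theorem touching_append (b : Bool) (c : ℤ) (a x : List Bool) :
    touching b c (a ++ x) =
      touching b c a ++ (touching b (c - ht a) x).map (a.length + ·) := by
  simp only [touching, List.length_append, List.range_add, List.filter_append, List.filter_map]
  congr 1
  · refine List.filter_congr fun i hi => ?_
    have hi : i < a.length := List.mem_range.1 hi
    simp only [List.getElem?_append_left hi, height, List.take_append_of_le_length hi.le,
      List.take_append_of_le_length (Nat.succ_le_of_lt hi)]
    rfl
  · congr 1
    refine List.filter_congr fun i _ => ?_
    simp only [Function.comp_apply, add_assoc, height_append, eq_sub_iff_add_eq',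
      List.getElem?_append_right (Nat.le_add_right _ _), Nat.add_sub_cancel_left]

theorem touching_cons (b : Bool) (c : ℤ) (b' : Bool) (x : List Bool) :
    touching b c (b' :: x) =
      (if b' = b ∧ (c = 0 ∨ c = rise b) then [0] else []) ++
        (touching b (c - rise b') x).map (1 + ·) := by
  have h := touching_append b c [b'] x
  rw [List.singleton_append] at h
  rw [h]
  congr 1
  · simp only [touching, List.length_singleton, List.range_one, List.filter_singleton]
    have : height [b'] 1 = rise b' := by simp [height]
    simp only [height_zero, zero_add, this, List.getElem?_cons_zero, Option.some.injEq]
    by_cases hb : b' = b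
    · subst hb
      simp only [true_and, eq_comm (a := (0 : ℤ)), eq_comm (a := rise b')]
      split_ifs <;> simp_all
    · simp [hb]
  · simp

/-- A down-step touching `y = c` starts on `y = c` or, if it ends there, on `y = c + 1`, and never
both. This turns ranks in `touching` into counts that are additive under concatenation. -/
theorem length_touching_false (c : ℤ) (x : List Bool) :
    (touching false c x).length = d c x + d (c + 1) x := by
  induction x generalizing c with
  | nil => rfl
  | cons b x ih =>
    rw [touching_cons, List.length_append, List.length_map, ih]
    cases b
    · simp only [d_cons_false, rise_false, true_and]
      rw [sub_neg_eq_add]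
      split_ifs <;> simp <;> omega
    · simp only [d_cons_true, rise_true]
      simp [add_comm]

theorem length_touching_true (c : ℤ) (x : List Bool) :
    (touching true c x).length = u c x + u (c - 1) x := by
  induction x generalizing c with
  | nil => rfl
  | cons b x ih =>
    rw [touching_cons, List.length_append, List.length_map, ih]
    cases b
    · simp only [u_cons_false, rise_false]
      simp [add_comm]
    · simp only [u_cons_true, rise_true, true_and]
      split_ifs <;> simp <;> omega

theorem flip_append (a b : List Bool) (s : Bool) :
    flip (a ++ s :: b) (some a.length) = a ++ (!s) :: b := by
  simp [flip, List.modify_eq_take_drop]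

/-- The height of `a` makes the displayed step touch `y = 0`. The prefix contains exactly `d 0`
earlier candidates, which is the 0-based rank selected by `g`. -/
theorem g_append {a b : List Bool} (ha : ht a = 0 ∨ ht a = 1)
    (hd : d 0 a + d 1 a = d 0 (a ++ false :: b)) :
    g (a ++ false :: b) = a ++ true :: b := by
  have hl : (touching false 0 a).length = d 0 (a ++ false :: b) := by
    rw [length_touching_false, ← hd, zero_add]
  have : (touching false 0 (a ++ false :: b))[d 0 (a ++ false :: b)]? = some a.length := by
    rw [touching_append, ← hl, List.getElem?_append_right le_rfl, touching_cons, if_pos]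
    · simp
    · rcases ha with ha | ha <;> simp [ha]
  rw [g, this, flip_append]; rfl

/-- The extra 1 comes from the 0-based rank `u 1 - 1`; it also rules out the degenerate case `u 1 =
0` of `h`. -/
theorem h_append {a b : List Bool} (ha : ht a = 0 ∨ ht a = 1)
    (hu : u 1 a + u 0 a + 1 = u 1 (a ++ true :: b)) :
    h (a ++ true :: b) = a ++ false :: b := by
  have hl : (touching true 1 a).length = u 1 (a ++ true :: b) - 1 := by
    rw [length_touching_true, ← hu, sub_self, Nat.add_sub_cancel]
  have : (touching true 1 (a ++ true :: b))[u 1 (a ++ true :: b) - 1]? = some a.length := by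
    rw [touching_append, ← hl, List.getElem?_append_right le_rfl, touching_cons, if_pos]
    · simp
    · rcases ha with ha | ha <;> simp [ha]
  rw [h, if_neg (by omega), this, flip_append]; rfl

/-! ### Dyck words -/

/-- Ordered forests, encoding Dyck words. -/
inductive Forest where
  | nil
  | node (B A : Forest)

namespace Forest

/-- The Dyck word of a forest, with steps away from the line `y = 0` of kind `b`. -/
def word (b : Bool) : Forest → List Bool
  | nil => []
  | node B A => b :: (word b B ++ (!b) :: word b A)

/-- The number of nodes. -/
def size : Forest → ℕ
  | nil => 0
  | node B A => size B + size A + 1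

/-- Concatenation of forests. -/
def append : Forest → Forest → Forest
  | nil, A => A
  | node B A, A' => node B (append A A')

@[simp] theorem word_nil (b : Bool) : word b nil = [] := rfl

@[simp] theorem word_node (b : Bool) (B A : Forest) :
    word b (node B A) = b :: (word b B ++ (!b) :: word b A) := rfl

theorem word_append (b : Bool) (A A' : Forest) :
    word b (append A A') = word b A ++ word b A' := by
  induction A with
  | nil => rfl
  | node B A _ ih => simp [append, ih]

@[simp] theorem length_word (b : Bool) (A : Forest) : (word b A).length = 2 * size A := by
  induction A with
  | nil => rfl
  | node B A ihB ihA => simp [size, ihA, ihB]; omega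

@[simp] theorem ht_word (b : Bool) (A : Forest) : ht (word b A) = 0 := by
  induction A with
  | nil => rfl
  | node B A ihB ihA => cases b <;> simp [ihA, ihB]

/-- A Dyck word stays on one side of its starting line. This and the next lemmas make whole words
invisible to the counts at the relevant heights. -/
theorem d_word_true {c : ℤ} (hc : c ≤ 0) (A : Forest) : d c (word true A) = 0 := by
  induction A generalizing c with
  | nil => rfl
  | node B A ihB ihA =>
    simp [ihB (show c - 1 ≤ 0 by omega), ihA hc]; omega

theorem u_word_true {c : ℤ} (hc : c < 0) (A : Forest) : u c (word true A) = 0 := by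
  induction A generalizing c with
  | nil => rfl
  | node B A ihB ihA =>
    simp [ihB (show c - 1 < 0 by omega), ihA hc]; omega

theorem fl_word_true {c : ℤ} (hc : c ≤ 0) (A : Forest) : fl c (word true A) = 0 := by
  induction A generalizing c with
  | nil => rfl
  | node B A ihB ihA =>
    simp [ihB (show c - 1 ≤ 0 by omega), ihA hc]; omega

theorem d_word_false {c : ℤ} (hc : 0 < c) (A : Forest) : d c (word false A) = 0 := by
  induction A generalizing c with
  | nil => rfl
  | node B A ihB ihA =>
    simp [ihB (show 0 < c + 1 by omega), ihA hc]; omega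

theorem u_word_false {c : ℤ} (hc : 0 ≤ c) (A : Forest) : u c (word false A) = 0 := by
  induction A generalizing c with
  | nil => rfl
  | node B A ihB ihA =>
    simp [ihB (show 0 ≤ c + 1 by omega), ihA hc]; omega

theorem fl_word_false {c : ℤ} (hc : 0 ≤ c) (A : Forest) : fl c (word false A) = size A := by
  induction A generalizing c with
  | nil => rfl
  | node B A ihB ihA =>
    simp [ihB (show 0 ≤ c + 1 by omega), ihA hc, hc, size]; omega

end Forest

/-- A word that goes to the far side of its starting line begins with a Dyck word. -/
theorem exists_word_prefix (b : Bool) (v : List Bool) :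
    (∃ A w, v = Forest.word b A ++ (!b) :: w) ∨ 0 ≤ rise b * ht v := by
  induction hn : v.length using Nat.strong_induction_on generalizing v with
  | _ n ih =>
  match v with
  | [] => right; simp
  | s :: v' =>
    by_cases hs : s = b
    · subst hs
      have hss : rise s * rise s = 1 := by cases s <;> rfl
      simp only [List.length_cons] at hn
      -- The first return only closes the arch opened by `s`, so a second crossing has to be found
      -- in the remainder `w`.
      rcases ih _ (by omega) v' rfl with ⟨A, w, rfl⟩ | h1
      · simp only [List.length_append, List.length_cons] at hn
        rcases ih _ (by omega) w rfl with ⟨A', w', rfl⟩ | h2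
        · exact .inl ⟨.node A A', w', by simp⟩
        · right
          have : rise (!s) = - rise s := by cases s <;> rfl
          simp only [ht_cons, ht_append, Forest.ht_word, this]
          linarith
      · right
        rw [ht_cons, mul_add]; omega
    · exact .inl ⟨.nil, v', by cases s <;> cases b <;> simp_all⟩

/-- The word of a list of arches `b A (!b)`. -/
def arches (S : List (Bool × Forest)) : List Bool :=
  S.flatMap fun s => s.1 :: (s.2.word s.1 ++ [!s.1])

/-- A balanced word is a sequence of arches. -/
theorem exists_arches (x : List Bool) (hx : ht x = 0) : ∃ S, x = arches S := by
  induction hn : x.length using Nat.strong_induction_on generalizing x with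
  | _ n ih =>
  match x with
  | [] => exact ⟨[], rfl⟩
  | s :: v =>
    have hr : rise (!s) = - rise s := by cases s <;> rfl
    rcases exists_word_prefix s v with ⟨A, w, rfl⟩ | h1
    · simp only [List.length_append, List.length_cons] at hn
      obtain ⟨S, rfl⟩ := ih _ (by omega) w (by simpa [hr] using hx) rfl
      exact ⟨(s, A) :: S, by simp [arches]⟩
    · rw [ht_cons] at hx
      cases s <;> simp at hx h1 <;> omega

end ChungFeller

namespace ChungFeller

/-! ### Half-steps of `f` -/

/-- The context `L`, `R` of a positive Dyck word that `f` traverses from left to right. -/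
structure CtxF (L R : List Bool) : Prop where
  ht_left : ht L = 0
  ht_right : ht R = 0
  crossings : d 1 L = d 0 R

/-- The context `L`, `R` of a positive Dyck word that `f` traverses from right to left. -/
structure CtxG (L R : List Bool) : Prop where
  ht_left : ht L = 1
  ht_right : ht R = 1
  crossings : u 0 L = u 0 R

variable {L R : List Bool} {B C Z : Forest}

/-- Pending arches may be moved into the right context and finished ones into the left: neither
contributes to `crossings`. For `CtxG` the sides are exchanged. -/
theorem CtxF.cons_word (hc : CtxF L R) (A : Forest) : CtxF L (Forest.word true A ++ R) :=
  ⟨hc.1, by simp [hc.2], by simp [Forest.d_word_true, hc.3]⟩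

theorem CtxF.append_word (hc : CtxF L R) (A : Forest) : CtxF (L ++ Forest.word false A) R :=
  ⟨by simp [hc.1], hc.2, by simp [Forest.d_word_false, hc.1, hc.3]⟩

theorem CtxG.cons_word (hc : CtxG L R) (A : Forest) : CtxG L (Forest.word false A ++ R) :=
  ⟨hc.1, by simp [hc.2], by simp [Forest.u_word_false, hc.3]⟩

theorem CtxG.append_word (hc : CtxG L R) (A : Forest) : CtxG (L ++ Forest.word true A) R :=
  ⟨by simp [hc.1], hc.2, by simp [Forest.u_word_true, hc.1, hc.3]⟩

theorem CtxF.u_eq_left (hc : CtxF L R) : u 0 L = d 1 L := by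
  have := u_sub_d 0 L
  simp [hc.1] at this
  omega

theorem CtxF.u_eq_right (hc : CtxF L R) : u (-1) R = d 0 R := by
  have := u_sub_d (-1) R
  simp [hc.2] at this
  omega

theorem CtxG.u_eq_left (hc : CtxG L R) : u 0 L = d 1 L + 1 := by
  have := u_sub_d 0 L
  simp [hc.1] at this
  omega

theorem CtxG.u_eq_right (hc : CtxG L R) : u 0 R = d 1 R + 1 := by
  have := u_sub_d 0 R
  simp [hc.2] at this
  omega

/-- Up- and down-crossings of one edge differ only by the endpoints of the word, so the condition on
down-steps becomes one on up-steps. The two new up-steps add one on each side. -/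
theorem CtxF.toG (hc : CtxF L R) : CtxG (L ++ [true]) (true :: R) :=
  ⟨by simp [hc.1], by simp [hc.2], by
    have h1 := hc.u_eq_left
    have h2 := hc.u_eq_right
    have h3 := hc.3
    simp [hc.1]; omega⟩

theorem CtxG.toF (hc : CtxG L R) : CtxF (L ++ [false]) (false :: R) :=
  ⟨by simp [hc.1], by simp [hc.2], by
    have h1 := hc.u_eq_left
    have h2 := hc.u_eq_right
    have h3 := hc.3
    simp [hc.1]; omega⟩

theorem CtxG.ofF (hc : CtxG (L ++ [true]) (true :: R)) : CtxF L R := by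
  have h1 : ht L = 0 := by have := hc.1; simp at this; omega
  have h2 : ht R = 0 := by have := hc.2; simp at this; omega
  refine ⟨h1, h2, ?_⟩
  have h3 := hc.3
  have h4 := u_sub_d 0 L
  have h5 := u_sub_d (-1) R
  simp [h1, h2] at h3 h4 h5
  omega

/-- `f` starts the traversal of an arch from left to right. -/
theorem CtxF.g_enter (hc : CtxF L R) :
    g ((L ++ true :: B.word true) ++ false :: R) = (L ++ true :: B.word true) ++ true :: R := by
  apply g_append
  · simp [hc.1]
  · simp [hc.1, hc.3, Forest.d_word_true]

/-- `f` starts the traversal of an arch from right to left. -/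
theorem CtxG.h_enter (hc : CtxG L R) :
    h (L ++ true :: (C.word true ++ false :: R)) = L ++ false :: (C.word true ++ false :: R) := by
  apply h_append
  · simp [hc.1]
  · simp [hc.1, hc.3, Forest.u_word_true]; omega

/-- `f` ends the traversal of an arch from right to left. -/
theorem CtxF.g_leave (hc : CtxF (L ++ [false]) (false :: R)) :
    g ((L ++ false :: Z.word false) ++ false :: R) = (L ++ false :: Z.word false) ++ true :: R := by
  have h0 := hc.1
  have h3 := hc.3
  simp at h0
  have h1 : ht L = 1 := by omega
  simp [h1] at h3
  apply g_append
  · simp [h1]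
  · simp [h1, Forest.d_word_false]; omega

/-- `f` ends the traversal of an arch from left to right. -/
theorem CtxG.h_leave (hc : CtxG (L ++ [true]) (true :: R)) :
    h (L ++ true :: (Z.word false ++ true :: R)) = L ++ false :: (Z.word false ++ true :: R) := by
  have h0 := hc.1
  have h3 := hc.3
  simp at h0
  simp [h0] at h3
  apply h_append
  · simp [h0]
  · simp [h0, Forest.u_word_false]; omega

/-- A state of the traversal: `half` tells whether `g` has been applied already, and then `h` is
next; `flawCount` is the number of flaws of the last path that was not half-way. -/
structure State where
  half : Bool
  path : List Bool
  cursor : ℕ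
  flawCount : ℕ

/-- The half-steps of the traversal with partner array `m`. -/
inductive HalfStep (m : ℕ → ℕ) : State → State → Prop
  -- A cursor on an up-step means that an arch is entered and its partner is flipped; a cursor on a
  -- down-step means that the arch closing there is left. For `h` the two kinds are exchanged.
  -- Writing `c' + 1 = m c` avoids truncated subtraction.
  | g {y : List Bool} {c c' p v : ℕ} (hc : c < y.length) (hp : p < y.length)
      (hc' : c' + 1 = m c) (hcy : c' < y.length)
      (hsel : y[c]? = some true ∧ p = m c ∨ y[c]? = some false ∧ p = c)
      (hg : ChungFeller.g y = y.set p true) :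
      HalfStep m ⟨false, y, c, v⟩ ⟨true, y.set p true, c', v⟩
  | h {y : List Bool} {c c' p v : ℕ} (hc : c < y.length) (hp : p < y.length)
      (hc' : c' = m c + 1) (hcy : c' ≤ y.length)
      (hsel : y[c]? = some false ∧ p = m c ∨ y[c]? = some true ∧ p = c)
      (hh : ChungFeller.h y = y.set p false)
      (hht : ht (y.set p false) = 0) (hv : flaws (y.set p false) = v + 1) :
      HalfStep m ⟨true, y, c, v⟩ ⟨false, y.set p false, c', v + 1⟩

/-- Sequences of half-steps. -/
abbrev Walk (m : ℕ → ℕ) : State → State → Prop := Relation.ReflTransGen (HalfStep m)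

/-- The array `m` contains the matching of the steps of the word of a forest starting at `o`. -/
def Matched (m : ℕ → ℕ) : ℕ → Forest → Prop
  | _, .nil => True
  | o, .node B A => m o = o + 2 * B.size + 1 ∧ m (o + 2 * B.size + 1) = o ∧
      Matched m (o + 1) B ∧ Matched m (o + 2 * B.size + 2) A

theorem set_append_cons (a b : List Bool) (s t : Bool) :
    (a ++ s :: b).set a.length t = a ++ t :: b := by simp

theorem CtxF.halfStep_enter {m : ℕ → ℕ} {v : ℕ} (hc : CtxF L R)
    (hm : m L.length = L.length + 2 * B.size + 1) :
    HalfStep m ⟨false, L ++ true :: (B.word true ++ false :: R), L.length, v⟩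
      ⟨true, L ++ true :: (B.word true ++ true :: R), L.length + 2 * B.size, v⟩ := by
  have hset : (L ++ true :: (B.word true ++ false :: R)).set (L.length + 2 * B.size + 1) true =
      L ++ true :: (B.word true ++ true :: R) := by
    simp [add_assoc]
  rw [← hset]
  refine .g (by simp) (by simp; omega) hm.symm (by simp; try omega) (.inl ⟨by simp, hm.symm⟩) ?_
  rw [hset]
  simpa using hc.g_enter (B := B)

/-- After `h`, the word `R` starts at height -1, hence the threshold 1 in `fl 1 R`. The new flaw is
the closing down-step of the arch, lowered to start on `y = 0`; the flipped step itself starts on `y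
= 1`. -/
theorem CtxG.halfStep_enter {m : ℕ → ℕ} {v : ℕ} (hc : CtxG L R)
    (hm : m (L.length + 2 * C.size + 1) = L.length)
    (hv : fl 0 L + fl 1 R = v) :
    HalfStep m ⟨true, L ++ true :: (C.word true ++ false :: R), L.length + 2 * C.size + 1, v⟩
      ⟨false, L ++ false :: (C.word true ++ false :: R), L.length + 1, v + 1⟩ := by
  have hset : (L ++ true :: (C.word true ++ false :: R)).set L.length false =
      L ++ false :: (C.word true ++ false :: R) := set_append_cons _ _ _ _
  rw [← hset]
  refine .h (by simp; omega) (by simp) (by rw [hm]) (by simp) (.inl ⟨?_, hm.symm⟩) ?_ ?_ ?_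
  · simp [add_assoc]
  · rw [hset]; exact hc.h_enter
  · rw [hset]; simp [hc.1, hc.2]
  · rw [hset, flaws_eq_fl, ← hv]; simp [hc.1, Forest.fl_word_true]; omega

theorem CtxF.halfStep_leave {m : ℕ → ℕ} {v c' : ℕ} (hc : CtxF (L ++ [false]) (false :: R))
    (hm : m (L.length + 2 * Z.size + 1) = c' + 1) (hcy : c' < L.length) :
    HalfStep m ⟨false, L ++ false :: (Z.word false ++ false :: R), L.length + 2 * Z.size + 1, v⟩
      ⟨true, L ++ false :: (Z.word false ++ true :: R), c', v⟩ := by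
  have hset : (L ++ false :: (Z.word false ++ false :: R)).set (L.length + 2 * Z.size + 1) true =
      L ++ false :: (Z.word false ++ true :: R) := by
    simp [add_assoc]
  rw [← hset]
  refine .g (by simp; omega) (by simp; omega) hm.symm (by simp; omega) (.inr ⟨?_, rfl⟩) ?_
  · simp [add_assoc]
  · rw [hset]
    simpa using hc.g_leave (Z := Z)

/-- Here the flipped step is the new flaw: it becomes a down-step starting on `y = 0`. -/
theorem CtxG.halfStep_leave {m : ℕ → ℕ} {v c' : ℕ} (hc : CtxG (L ++ [true]) (true :: R))
    (hm : m L.length + 1 = c') (hcy : c' = L.length + 2 * Z.size + 2)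
    (hv : fl 0 L + Z.size + fl 0 R = v) :
    HalfStep m ⟨true, L ++ true :: (Z.word false ++ true :: R), L.length, v⟩
      ⟨false, L ++ false :: (Z.word false ++ true :: R), c', v + 1⟩ := by
  have hF := hc.ofF
  have hset : (L ++ true :: (Z.word false ++ true :: R)).set L.length false =
      L ++ false :: (Z.word false ++ true :: R) := set_append_cons _ _ _ _
  rw [← hset]
  refine .h (by simp) (by simp) hm.symm (by simp; omega) (.inr ⟨by simp, rfl⟩) ?_ ?_ ?_
  · rw [hset]; exact hc.h_leave
  · rw [hset]; simp [hF.1, hF.2]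
  · rw [hset, flaws_eq_fl, ← hv]; simp [hF.1, Forest.fl_word_false]; omega

/-- The traversal of a positive Dyck word, from left to right and from right to left. -/
theorem walk_word {m : ℕ → ℕ} (A : Forest) : ∀ (L R : List Bool) (v : ℕ),
    Matched m L.length A →
    (CtxF L R → fl 0 L + fl 0 R = v →
      Walk m ⟨false, L ++ (A.word true ++ R), L.length, v⟩
        ⟨false, L ++ (A.word false ++ R), L.length + 2 * A.size, v + A.size⟩) ∧
    (∀ c c', CtxG L R → fl 0 L + fl 1 R = v → c + 1 = L.length + 2 * A.size →
      c' + 1 = L.length →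
      Walk m ⟨true, L ++ (A.word true ++ R), c, v⟩
        ⟨true, L ++ (A.word false ++ R), c', v + A.size⟩) := by
  induction A with
  | nil =>
    refine fun L R v _ => ⟨fun _ _ => .refl, fun c c' _ _ h1 h2 => ?_⟩
    obtain rfl : c = c' := by simp [Forest.size] at h1; omega
    exact .refl
  | node B A ihB ihA =>
    rintro L R v ⟨hm1, hm2, hmB, hmA⟩
    constructor
    · intro hc hv
      have hc0 := hc.cons_word A
      refine .head (by simpa using hc0.halfStep_enter (B := B) hm1) ?_
      -- Both ends of the arch now point up, and the cursor is on the last step of `B`, or on the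
      -- opening step if `B` is empty.
      have w1 := (ihB (L ++ [true]) (true :: (A.word true ++ R)) v (by simpa using hmB)).2
        (L.length + 2 * B.size) L.length hc0.toG (by
          simp [Forest.fl_word_true, hc.1]; omega) (by simp; omega) (by simp)
      refine .trans (by simpa using w1) ?_
      refine .head (hc0.toG.cons_word B |> fun h => CtxG.halfStep_leave (Z := B) (L := L)
        (R := A.word true ++ R) (c' := L.length + 2 * B.size + 2) ?_ (by omega) rfl ?_) ?_
      · exact hc0.toG
      · simp [Forest.fl_word_true]; omega
      -- The finished arch, now negative, joins the left context.
      have hc2 : CtxF (L ++ (Forest.node B .nil).word false) R := hc.append_word _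
      have w2 := (ihA _ R (v + B.size + 1) (by
        simpa [Forest.size, mul_add, add_assoc] using hmA)).1 hc2 (by
          simp [hc.1, Forest.fl_word_false]; omega)
      convert w2 using 2
      all_goals simp [Forest.size]
      all_goals omega
    · intro c c' hc hv h1 h2
      -- From right to left the arches of `A` are traversed first, with the still positive arch
      -- around `B` in the left context.
      have hcA : CtxG (L ++ (Forest.node B .nil).word true) R := hc.append_word _
      have w1 := (ihA _ R v (by
        simpa [Forest.size, mul_add, add_assoc] using hmA)).2 c (L.length + 2 * B.size + 1) hcA (by
          simp [hc.1, Forest.fl_word_true]; omega) (by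
          simp [Forest.size, mul_add] at h1 ⊢; omega) (by simp; omega)
      refine .trans (by simpa using w1) ?_
      have hc0 := hc.cons_word A
      refine .head (hc0.halfStep_enter hm2 (v := v + A.size) (by
        simp [Forest.fl_word_false]; omega)) ?_
      have w2 := (ihB (L ++ [false]) (false :: (A.word false ++ R)) (v + A.size + 1)
        (by simpa using hmB)).1 hc0.toF (by
          simp [hc.1, Forest.fl_word_false]; omega)
      refine .trans (by simpa using w2) ?_
      have hs := CtxF.halfStep_leave (Z := B) (L := L) (R := A.word false ++ R) (m := m)
        (c' := c') (v := v + A.size + 1 + B.size) hc0.toF (by omega) (by omega)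
      refine .single ?_
      simpa [Forest.size, add_assoc, add_comm, add_left_comm] using hs

/-! ### The traversal from an arbitrary balanced path -/

theorem Forest.size_append (A A' : Forest) : (A.append A').size = A.size + A'.size := by
  induction A with
  | nil => simp [Forest.append, Forest.size]
  | node B A _ ih => simp [Forest.append, Forest.size, ih]; omega

/-- A balanced path as a sequence of arches, grouped according to the order of the traversal. In
`cross B X K`, the positive arch around `B` and the negative arch around `K` are the two ends of
one arch whose traversal is not finished yet. -/
inductive Layout where
  | nil
  | neg (K : Forest) (X : Layout)
  | pos (X : Layout) (Q : Forest)
  | cross (B : Forest) (X : Layout) (K : Forest)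

namespace Layout

/-- The path with the given layout. -/
def word : Layout → List Bool
  | nil => []
  | neg K X => false :: (K.word false ++ true :: word X)
  | pos X Q => word X ++ true :: (Q.word true ++ [false])
  | cross B X K =>
      true :: (B.word true ++ false :: (word X ++ false :: (K.word false ++ [true])))

/-- The forest of the path at the end of the traversal. -/
def toForest : Layout → Forest
  | nil => .nil
  | neg K X => .node K (toForest X)
  | pos X Q => (toForest X).append (.node Q .nil)
  | cross B X K => .node (B.append (.node (toForest X) K)) .nil

/-- The position at which the traversal continues. -/
def start : Layout → ℕ
  | nil => 0
  | neg K X => 2 * K.size + 2 + start X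
  | pos X _ => start X
  | cross B X _ => 2 * B.size + 2 + start X

/-- The array `m` contains the partners that are used in the rest of the traversal. -/
def Partners (m : ℕ → ℕ) : ℕ → Layout → Prop
  | _, nil => True
  | o, neg K X => Partners m (o + 2 * K.size + 2) X
  | o, pos X Q => Partners m o X ∧ Matched m (o + 2 * X.toForest.size) (.node Q .nil)
  | o, cross B X K => Matched m (o + 1) B ∧ Partners m (o + 2 * B.size + 2) X ∧
      m o = o + 2 * B.size + 2 * X.toForest.size + 2 * K.size + 3 ∧
      m (o + 2 * B.size + 2 * X.toForest.size + 2) = o + 2 * B.size + 1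

@[simp] theorem ht_word (X : Layout) : ht X.word = 0 := by
  induction X <;> simp [word, *]

@[simp] theorem length_word (X : Layout) : X.word.length = 2 * X.toForest.size := by
  induction X <;> simp [word, toForest, Forest.size, Forest.size_append, *] <;> omega

end Layout

/-- In the case `cross`, the outer arch has been entered by `g`, `K` is done, and the inner arch
around `X` has been entered by `h`. After `X`, what remains is to leave the inner arch, traverse `B`
from right to left, and leave the outer arch. -/
theorem walk_layout {m : ℕ → ℕ} (X : Layout) : ∀ (L R : List Bool) (v w : ℕ),
    X.Partners m L.length → CtxF L R → fl 0 L + fl 0 X.word + fl 0 R = v →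
    fl 0 L + X.toForest.size + fl 0 R = w →
    Walk m ⟨false, L ++ (X.word ++ R), L.length + X.start, v⟩
      ⟨false, L ++ (X.toForest.word false ++ R), L.length + 2 * X.toForest.size, w⟩ := by
  induction X with
  | nil =>
    rintro L R v w - - h1 h2
    obtain rfl : v = w := by rw [← h1, ← h2]; rfl
    exact .refl
  | neg K X ih =>
    rintro L R v w hm hc rfl rfl
    have hc2 : CtxF (L ++ (Forest.node K .nil).word false) R := hc.append_word _
    have w1 := ih _ R _ _ (by simpa [Layout.Partners, Forest.size, mul_add, add_assoc] using hm)
      hc2 rfl rfl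
    convert w1 using 2 <;>
      simp [Layout.word, Layout.toForest, Layout.start, Forest.size, hc.1, Forest.fl_word_false] <;>
      omega
  | pos X Q ih =>
    rintro L R v w ⟨hmX, hmQ⟩ hc rfl rfl
    have hc2 : CtxF L ((Forest.node Q .nil).word true ++ R) := hc.cons_word _
    refine .trans (b := ⟨false, L ++ (X.toForest.word false ++
      ((Forest.node Q .nil).word true ++ R)), L.length + 2 * X.toForest.size,
      fl 0 L + X.toForest.size + fl 0 R⟩) ?_ ?_
    · convert ih L _ (fl 0 L + fl 0 (X.pos Q).word + fl 0 R)
        (fl 0 L + X.toForest.size + fl 0 R) hmX hc2 ?_ ?_ using 2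
      · simp [Layout.word]
      · rfl
      · simp [Layout.word, Forest.fl_word_true]
      · simp [Forest.fl_word_true]
    · have hc3 := hc.append_word X.toForest
      have w2 := (walk_word (.node Q .nil) _ R (fl 0 L + X.toForest.size + fl 0 R)
        (by simpa using hmQ)).1 hc3 (by simp [hc.1, Forest.fl_word_false])
      convert w2 using 2
      · simp
      · simp
      · simp [Layout.toForest, Forest.word_append]
      · simp [Layout.toForest, Forest.size_append]; omega
      · simp [Layout.toForest, Forest.size_append]; omega
  | cross B X K ih =>
    rintro L R v w ⟨hmB, hmX, hma, hmq⟩ hc rfl rfl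
    have hcG : CtxG (L ++ [true]) ((Forest.node X.toForest K).word false ++ true :: R) :=
      hc.toG.cons_word _
    have hcX : CtxF (L ++ true :: (B.word true ++ [false]))
        (false :: (K.word false ++ true :: R)) := by
      have := (((hc.toG.append_word B).cons_word K).toF)
      simpa using this
    have w1 := ih _ _ _ _ (by simpa [add_assoc] using hmX) hcX rfl rfl
    refine .trans (b := ⟨false, (L ++ true :: B.word true) ++ false :: (X.toForest.word false ++
      false :: (K.word false ++ true :: R)), (L ++ true :: B.word true).length +
        2 * X.toForest.size + 1, fl 0 L + X.toForest.size + 1 + K.size + fl 0 R⟩) ?_ ?_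
    · convert w1 using 2 <;>
        simp [Layout.word, Layout.start, Forest.fl_word_true, Forest.fl_word_false, hc.1] <;> omega
    -- `g` leaves the inner arch; its rewired partner sends the cursor to the end of `B`.
    refine .head (CtxF.halfStep_leave (c' := L.length + 2 * B.size) (by
      simpa using hcX) ?_ ?_) ?_
    · convert hmq using 2; simp; omega
    · simp
    refine .trans (b := ⟨true, L ++ true :: ((B.append (.node X.toForest K)).word false ++
      true :: R), L.length, fl 0 L + X.toForest.size + 1 + K.size + fl 0 R + B.size⟩) ?_ ?_
    · have w2 := (walk_word B _ _ (fl 0 L + X.toForest.size + 1 + K.size + fl 0 R)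
        (by simpa using hmB)).2 (L.length + 2 * B.size) L.length hcG (by
          simp [hc.1, Forest.fl_word_false]; omega) (by simp; omega) (by simp)
      convert w2 using 2 <;> simp [Forest.word_append]
    -- `h` leaves the outer arch from its opening step.
    · refine .single ?_
      have hs := CtxG.halfStep_leave (m := m) (Z := B.append (.node X.toForest K)) (L := L) (R := R)
        (c' := L.length + 2 * (B.append (.node X.toForest K)).size + 2)
        (v := fl 0 L + X.toForest.size + 1 + K.size + fl 0 R + B.size) hc.toG
        (by rw [hma]; simp [Forest.size_append, Forest.size]; omega) rfl
        (by simp [Forest.size_append, Forest.size]; omega)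
      convert hs using 2
      all_goals simp [Layout.toForest, Forest.size, Forest.size_append]
      all_goals omega

/-- Two half-steps, which together apply `f` to the path `y`. -/
def FullStep (m : ℕ → ℕ) (v : ℕ) (y : List Bool) (c : ℕ) (y' : List Bool) (c' : ℕ) : Prop :=
  ∃ z b, HalfStep m ⟨false, y, c, v⟩ ⟨true, z, b, v⟩ ∧
    HalfStep m ⟨true, z, b, v⟩ ⟨false, y', c', v + 1⟩

theorem FullStep.eq_f {m : ℕ → ℕ} {v c c' : ℕ} {y y' : List Bool} (hs : FullStep m v y c y' c') :
    y' = f y := by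
  obtain ⟨z, b, h1, h2⟩ := hs
  cases h1 with | g _ _ _ _ _ hg => cases h2 with | h _ _ _ _ _ hh => rw [f, hg, hh]

/-- A walk of `n` full steps from the path `y` with `v` flaws and the cursor at `c`, to a state with
`v'` flaws and the cursor at `c'`. -/
def FullWalk (m : ℕ → ℕ) (y : List Bool) (c v c' v' : ℕ) : Prop :=
  ∃ (n : ℕ) (cur : ℕ → ℕ), cur 0 = c ∧ cur n = c' ∧ v + n = v' ∧
    ∀ i < n, FullStep m (v + i) (f^[i] y) (cur i) (f^[i + 1] y) (cur (i + 1))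

theorem FullWalk.head {m : ℕ → ℕ} {y y' : List Bool} {c v c₁ c' v' : ℕ}
    (hs : FullStep m v y c y' c₁) (hw : FullWalk m y' c₁ (v + 1) c' v') :
    FullWalk m y c v c' v' := by
  obtain ⟨n, cur, h0, hn, hv, hi⟩ := hw
  refine ⟨n + 1, fun i => if i = 0 then c else cur (i - 1), by simp, by simpa using hn, by omega,
    fun i hin => ?_⟩
  rcases i with - | i
  · simpa [h0, ← hs.eq_f] using hs
  · have := hi i (by omega)
    rw [hs.eq_f, ← Function.iterate_succ_apply, ← Function.iterate_succ_apply] at this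
    simpa [add_assoc, add_comm, add_left_comm] using this

/-- Half-steps alternate, so they pair up. The second clause covers a suffix that begins between `g`
and `h`, as the induction needs. -/
theorem Walk.fullWalk {m : ℕ → ℕ} {s t : State} (hw : Walk m s t) (ht : t.half = false) :
    (s.half = false → FullWalk m s.path s.cursor s.flawCount t.cursor t.flawCount) ∧
    (s.half = true → ∃ s', HalfStep m s s' ∧
      FullWalk m s'.path s'.cursor s'.flawCount t.cursor t.flawCount) := by
  induction hw using Relation.ReflTransGen.head_induction_on with
  | refl => exact ⟨fun _ => ⟨0, fun _ => t.cursor, rfl, rfl, rfl, by simp⟩, by simp [ht]⟩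
  | head hs _ ih =>
    cases hs with
    | g hc hp hc' hcy hsel hg =>
      refine ⟨fun _ => ?_, by simp⟩
      obtain ⟨s', hs', hw⟩ := ih.2 rfl
      cases hs' with
      | h hc₁ hp₁ hc₁' hcy₁ hsel₁ hh hht hv =>
        exact .head ⟨_, _, .g hc hp hc' hcy hsel hg,
          .h hc₁ hp₁ hc₁' hcy₁ hsel₁ hh hht hv⟩ hw
    | h hc hp hc' hcy hsel hh hht hv =>
      exact ⟨by simp, fun _ => ⟨_, .h hc hp hc' hcy hsel hh hht hv, ih.1 rfl⟩⟩

theorem FullStep.mem_D {m : ℕ → ℕ} {k v c c' : ℕ} {y y' : List Bool}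
    (hs : FullStep m v y c y' c') (hy : y.length = 2 * k) : y' ∈ D k (v + 1) := by
  obtain ⟨z, b, h1, h2⟩ := hs
  obtain ⟨hl, hht, hv⟩ : y'.length = 2 * k ∧ ht y' = 0 ∧ flaws y' = v + 1 := by
    cases h1 with
    | g => cases h2 with
      | h _ _ _ _ _ _ hht hv => exact ⟨by simpa using hy, hht, hv⟩
  refine ⟨hl, ?_, hv⟩
  have := ht_add_length y'
  omega

/-- The traversal of a balanced path ends with a path all of whose down-steps are flaws. -/
theorem fullWalk_layout {m : ℕ → ℕ} (X : Layout) (hm : X.Partners m 0) :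
    FullWalk m X.word X.start (flaws X.word) (2 * X.toForest.size) X.toForest.size := by
  have := (walk_layout (m := m) X [] [] _ _ hm ⟨rfl, rfl, rfl⟩ rfl rfl).fullWalk rfl |>.1 rfl
  simpa [flaws_eq_fl] using this

end ChungFeller

namespace ChungFeller

/-! ### Executions without output -/

/-- From the configuration `c` the program `P` reaches `c'` in `n` steps, without output and within
the bounds `S` on addresses and `W` on words, provided that `c` is within the bound on words. -/
def Reach (P : Program) (S W : ℕ) (c : Config) (n : ℕ) (c' : Config) : Prop :=
  WordsAtMost W c → run P c n = c' ∧ WordsAtMost W c' ∧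
    ∀ t < n, AccessesBelow P S (run P c t) ∧ WordsAtMost W (run P c t) ∧ ¬Emits P (run P c t)

variable {P : Program} {S W : ℕ}

theorem run_add (c : Config) (n t : ℕ) : run P c (n + t) = run P (run P c n) t := by
  simp [run, add_comm n t, Function.iterate_add_apply]

theorem run_succ (c : Config) (t : ℕ) : run P c (t + 1) = run P (step P c) t := rfl

theorem Reach.refl (c : Config) : Reach P S W c 0 c := fun hc => ⟨rfl, hc, by simp⟩

theorem Reach.trans {c₁ c₂ c₃ : Config} {n₁ n₂ : ℕ} (h₁ : Reach P S W c₁ n₁ c₂)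
    (h₂ : Reach P S W c₂ n₂ c₃) : Reach P S W c₁ (n₁ + n₂) c₃ := by
  intro hc
  obtain ⟨hr₁, hw₁, ht₁⟩ := h₁ hc
  obtain ⟨hr₂, hw₂, ht₂⟩ := h₂ hw₁
  refine ⟨by rw [run_add, hr₁, hr₂], hw₂, fun t ht => ?_⟩
  rcases lt_or_ge t n₁ with hlt | hge
  · exact ht₁ t hlt
  · obtain ⟨s, rfl⟩ := Nat.exists_eq_add_of_le hge
    rw [run_add, hr₁]
    exact ht₂ s (by omega)

theorem Reach.head {c c' : Config} {n : ℕ} {i : Instr} (hi : P[c.pc]? = some i)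
    (he : i ≠ .emit) (ha : ∀ a ∈ i.address c, a < S)
    (hw : WordsAtMost W c → WordsAtMost W (i.exec c)) (h : Reach P S W (i.exec c) n c') :
    Reach P S W c (n + 1) c' := by
  intro hc
  have hstep : step P c = i.exec c := by rw [step, hi]
  obtain ⟨hr, hw', ht⟩ := h (hw hc)
  refine ⟨by rw [run_succ, hstep, hr], hw', fun t ht' => ?_⟩
  rcases t with - | t
  · refine ⟨fun j hj => ?_, hc, ?_⟩
    · obtain rfl : i = j := by simpa [run, hi] using hj
      exact ha
    · simp only [Emits, run, Function.iterate_zero, id_eq, hi, Option.some.injEq]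
      exact he
  · rw [run_succ, hstep]
    exact ht t (by omega)

theorem WordsAtMost.update_reg {pc pc' : ℕ} {reg mem : ℕ → ℕ} {r v : ℕ}
    (hc : WordsAtMost W ⟨pc, reg, mem⟩) (hv : v ≤ W) :
    WordsAtMost W ⟨pc', Function.update reg r v, mem⟩ := by
  refine ⟨fun s => ?_, hc.2⟩
  by_cases hs : s = r
  · simpa [hs] using hv
  · simpa [Function.update_of_ne hs] using hc.1 s

variable {pc n : ℕ} {reg mem : ℕ → ℕ} {c' : Config}

theorem Reach.const {r v : ℕ} (hi : P[pc]? = some (.const r v)) (hv : v ≤ W)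
    (h : Reach P S W ⟨pc + 1, Function.update reg r v, mem⟩ n c') :
    Reach P S W ⟨pc, reg, mem⟩ (n + 1) c' :=
  .head hi (by simp) (by simp [Instr.address]) (fun hc => hc.update_reg hv) h

/-- The explicit value arguments here and below keep register contents in closed form during
symbolic execution. -/
theorem Reach.move {r s : ℕ} (v : ℕ) (hi : P[pc]? = some (.move r s)) (hv : reg s = v)
    (h : Reach P S W ⟨pc + 1, Function.update reg r v, mem⟩ n c') :
    Reach P S W ⟨pc, reg, mem⟩ (n + 1) c' := by
  subst hv
  exact .head hi (by simp) (by simp [Instr.address]) (fun hc => hc.update_reg (hc.1 s)) h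

theorem Reach.add {r s t : ℕ} (v : ℕ) (hi : P[pc]? = some (.add r s t)) (hv : reg s + reg t = v)
    (hvW : v ≤ W) (h : Reach P S W ⟨pc + 1, Function.update reg r v, mem⟩ n c') :
    Reach P S W ⟨pc, reg, mem⟩ (n + 1) c' := by
  subst hv
  exact .head hi (by simp) (by simp [Instr.address]) (fun hc => hc.update_reg hvW) h

theorem Reach.sub {r s t : ℕ} (v : ℕ) (hi : P[pc]? = some (.sub r s t)) (hv : reg s - reg t = v)
    (h : Reach P S W ⟨pc + 1, Function.update reg r v, mem⟩ n c') :
    Reach P S W ⟨pc, reg, mem⟩ (n + 1) c' := by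
  subst hv
  exact .head hi (by simp) (by simp [Instr.address])
    (fun hc => hc.update_reg ((Nat.sub_le _ _).trans (hc.1 s))) h

theorem Reach.load {r s : ℕ} (a v : ℕ) (hi : P[pc]? = some (.load r s)) (ha : reg s = a)
    (haS : a < S) (hv : mem a = v)
    (h : Reach P S W ⟨pc + 1, Function.update reg r v, mem⟩ n c') :
    Reach P S W ⟨pc, reg, mem⟩ (n + 1) c' := by
  subst hv ha
  exact .head hi (by simp) (by simpa [Instr.address] using haS)
    (fun hc => hc.update_reg (hc.2 _)) h

theorem Reach.store {r s : ℕ} (a v : ℕ) (hi : P[pc]? = some (.store r s)) (ha : reg r = a)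
    (haS : a < S) (hv : reg s = v)
    (h : Reach P S W ⟨pc + 1, reg, Function.update mem a v⟩ n c') :
    Reach P S W ⟨pc, reg, mem⟩ (n + 1) c' := by
  subst hv ha
  refine .head hi (by simp) (by simpa [Instr.address] using haS) (fun hc => ⟨hc.1, fun a => ?_⟩) h
  by_cases hs : a = reg r
  · simpa [Instr.exec, hs] using hc.1 s
  · simpa [Instr.exec, Function.update_of_ne hs] using hc.2 a

theorem Reach.jump {l : ℕ} (hi : P[pc]? = some (.jump l))
    (h : Reach P S W ⟨l, reg, mem⟩ n c') : Reach P S W ⟨pc, reg, mem⟩ (n + 1) c' :=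
  .head hi (by simp) (by simp [Instr.address]) (fun hc => hc) h

theorem Reach.jumpEq_pos {r s l : ℕ} (hi : P[pc]? = some (.jumpEq r s l)) (hrs : reg r = reg s)
    (h : Reach P S W ⟨l, reg, mem⟩ n c') : Reach P S W ⟨pc, reg, mem⟩ (n + 1) c' :=
  .head hi (by simp) (by simp [Instr.address]) (fun hc => hc)
    (by simpa only [Instr.exec, hrs, if_true] using h)

theorem Reach.jumpEq_neg {r s l : ℕ} (hi : P[pc]? = some (.jumpEq r s l)) (hrs : reg r ≠ reg s)
    (h : Reach P S W ⟨pc + 1, reg, mem⟩ n c') : Reach P S W ⟨pc, reg, mem⟩ (n + 1) c' :=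
  .head hi (by simp) (by simp [Instr.address]) (fun hc => hc)
    (by simpa only [Instr.exec, hrs, if_false] using h)

/-! ### The program -/

/-- The program. Registers: `2` holds the length `N` of the path, `3` holds `1`, `9` holds `0`,
`4` and `10` hold positions. The partner of position `a` is stored at address `N + a`; while the
partners are computed, the unmatched positions form a linked list that ends with `N`. -/
def program : Program := [
  -- `0`: constants
  .const 3 1, .add 2 0 0, .move 5 2,
  -- `3`: match the steps of the path
  .jumpEq 4 2 19, .add 6 2 4, .jumpEq 5 2 15, .load 7 4, .load 8 5, .jumpEq 7 8 15,
  .add 7 2 5, .load 8 7, .store 7 4, .store 6 5, .move 5 8, .jump 17,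
  .store 6 5, .move 5 4,
  .add 4 4 3, .jump 3,
  -- `19`: connect positive arches on the left with negative arches on the right
  .jumpEq 10 4 39, .load 6 10, .jumpEq 6 9 35, .sub 7 4 3, .load 6 7, .add 8 2 7, .load 8 8,
  .jumpEq 6 9 33, .add 5 2 10, .load 6 5, .store 5 7, .add 5 2 8, .store 5 6, .add 10 6 3,
  .move 4 8, .jump 19,
  .add 6 2 10, .load 6 6, .add 10 6 3, .jump 19,
  -- `39`: apply `g`
  .jumpEq 10 2 60, .add 5 2 10, .load 5 5, .load 6 10, .jumpEq 6 3 46, .store 10 3, .jump 48,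
  .store 5 3, .jump 48, .sub 10 5 3,
  -- `49`: apply `h`
  .add 5 2 10, .load 5 5, .load 6 10, .jumpEq 6 3 55, .store 5 9, .jump 57,
  .store 10 9, .jump 57, .add 10 5 3,
  -- `58`: output
  .emit, .jump 39]

/-- The word `w` is stored in memory from address `o` on. -/
def Stored (mem : ℕ → ℕ) : ℕ → List Bool → Prop
  | _, [] => True
  | o, b :: w => mem o = b.toNat ∧ Stored mem (o + 1) w

@[simp] theorem stored_nil (mem : ℕ → ℕ) (o : ℕ) : Stored mem o [] := trivial

@[simp] theorem stored_cons (mem : ℕ → ℕ) (o : ℕ) (b : Bool) (w : List Bool) :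
    Stored mem o (b :: w) ↔ mem o = b.toNat ∧ Stored mem (o + 1) w := Iff.rfl

@[simp] theorem stored_append (mem : ℕ → ℕ) (o : ℕ) (w w' : List Bool) :
    Stored mem o (w ++ w') ↔ Stored mem o w ∧ Stored mem (o + w.length) w' := by
  induction w generalizing o with
  | nil => simp
  | cons b w ih => simp [ih, and_assoc, add_assoc, add_comm 1]

theorem Stored.congr {mem mem' : ℕ → ℕ} {o : ℕ} {w : List Bool} (hs : Stored mem o w)
    (heq : ∀ a, o ≤ a → a < o + w.length → mem' a = mem a) : Stored mem' o w := by
  induction w generalizing o with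
  | nil => trivial
  | cons b w ih =>
    simp only [List.length_cons] at heq
    exact ⟨(heq o le_rfl (by omega)).trans hs.1, ih hs.2 fun a h1 h2 =>
      heq a (by omega) (by omega)⟩

theorem stored_iff_getElem? (mem : ℕ → ℕ) (o : ℕ) (w : List Bool) :
    Stored mem o w ↔ ∀ a b, w[a]? = some b → mem (o + a) = b.toNat := by
  induction w generalizing o with
  | nil => simp
  | cons b w ih =>
    rw [stored_cons, ih]
    refine ⟨fun ⟨h1, h2⟩ a b' hb => ?_, fun hs => ⟨by simpa using hs 0 b rfl, fun a b' hb => ?_⟩⟩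
    · rcases a with - | a
      · obtain rfl : b = b' := by simpa using hb
        exact h1
      · rw [add_comm a, ← add_assoc]
        exact h2 a b' (by simpa using hb)
    · rw [add_assoc, add_comm 1]
      exact hs (a + 1) b' (by simpa using hb)

theorem Matched.congr {m m' : ℕ → ℕ} {o : ℕ} {A : Forest} (hm : Matched m o A)
    (heq : ∀ a, o ≤ a → a < o + 2 * A.size → m' a = m a) : Matched m' o A := by
  induction A generalizing o with
  | nil => trivial
  | node B A ihB ihA =>
    obtain ⟨h1, h2, h3, h4⟩ := hm
    simp only [Forest.size] at heq
    refine ⟨(heq _ le_rfl (by omega)).trans h1, (heq _ (by omega) (by omega)).trans h2,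
      ihB h3 fun a h5 h6 => heq a (by omega) (by omega),
      ihA h4 fun a h5 h6 => heq a (by omega) (by omega)⟩

/-! ### The computation of the matching -/

/-- The registers while the steps are matched; `i` is the current position and `t` is the last
unmatched position. -/
structure ScanRegs (reg : ℕ → ℕ) (N i t : ℕ) : Prop where
  r2 : reg 2 = N
  r3 : reg 3 = 1
  r4 : reg 4 = i
  r5 : reg 5 = t
  r9 : reg 9 = 0
  r10 : reg 10 = 0

/-- All unmatched steps are of one kind, so a step of the kind on top of the stack, or any step on
an empty stack (`t = N`), is pushed. The unused partner cell holds the link to the previous top. -/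
theorem reach_push {N i t : ℕ} {b : Bool} (hr : ScanRegs reg N i t) (hi : i < N) (hW : 2 * N ≤ W)
    (hS : 2 * N ≤ S) (hb : mem i = b.toNat) (ht : t = N ∨ t < N ∧ mem t = b.toNat) :
    ∃ n reg', n ≤ 14 ∧
      Reach program S W ⟨3, reg, mem⟩ n ⟨3, reg', Function.update mem (N + i) t⟩ ∧
      ScanRegs reg' N (i + 1) i := by
  obtain ⟨h2, h3, h4, h5, h9, h10⟩ := hr
  -- Both tests for pushing lead to the same code.
  have tail : ∀ reg : ℕ → ℕ, reg 2 = N → reg 3 = 1 → reg 4 = i → reg 5 = t → reg 6 = N + i →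
      reg 9 = 0 → reg 10 = 0 → ∃ reg',
      Reach program S W ⟨15, reg, mem⟩ 4 ⟨3, reg', Function.update mem (N + i) t⟩ ∧
      ScanRegs reg' N (i + 1) i := by
    intro reg h2 h3 h4 h5 h6 h9 h10
    refine ⟨_, .store (N + i) t rfl h6 (by omega) h5 <| .move i rfl h4 <|
      .add (i + 1) rfl (by simp [h4, h3]) (by omega) <| .jump rfl <| .refl _, ?_⟩
    constructor <;> simp [*]
  rcases ht with rfl | ⟨ht, hbt⟩
  · obtain ⟨reg', h, h'⟩ := tail (Function.update reg 6 (t + i)) (by simp [h2]) (by simp [h3])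
      (by simp [h4]) (by simp [h5]) (by simp) (by simp [h9]) (by simp [h10])
    exact ⟨_, reg', by norm_num, .jumpEq_neg rfl (by omega) <| .add (t + i) rfl (by rw [h2, h4])
      (by omega) <| .jumpEq_pos rfl (by simp [h5, h2]) h, h'⟩
  · obtain ⟨reg', h, h'⟩ := tail (Function.update (Function.update (Function.update reg 6 (N + i))
      7 b.toNat) 8 b.toNat) (by simp [h2]) (by simp [h3])
      (by simp [h4]) (by simp [h5]) (by simp) (by simp [h9]) (by simp [h10])
    exact ⟨_, reg', by norm_num, .jumpEq_neg rfl (by omega) <| .add (N + i) rfl (by rw [h2, h4])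
      (by omega) <| .jumpEq_neg rfl (by simp [h5, h2]; omega) <|
      .load i b.toNat rfl (by simp [h4]) (by omega) hb <|
      .load t b.toNat rfl (by simp [h5]) (by omega) hbt <| .jumpEq_pos rfl (by simp) h, h'⟩

/-- Opposite kinds match. The link must be read before the partner overwrites it. -/
theorem reach_pop {N i t t' : ℕ} {b : Bool} (hr : ScanRegs reg N i t) (hi : i < N) (hW : 2 * N ≤ W)
    (hS : 2 * N ≤ S) (hb : mem i = (!b).toNat) (ht : t < N) (hbt : mem t = b.toNat)
    (ht' : mem (N + t) = t') :
    ∃ n reg', n ≤ 14 ∧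
      Reach program S W ⟨3, reg, mem⟩ n
        ⟨3, reg', Function.update (Function.update mem (N + t) i) (N + i) t⟩ ∧
      ScanRegs reg' N (i + 1) t' := by
  obtain ⟨h2, h3, h4, h5, h9, h10⟩ := hr
  refine ⟨_, _, ?_, .jumpEq_neg rfl (by omega) <| .add (N + i) rfl (by rw [h2, h4]) (by omega) <|
    .jumpEq_neg rfl (by simp [h5, h2]; omega) <|
    .load i (!b).toNat rfl (by simp [h4]) (by omega) hb <|
    .load t b.toNat rfl (by simp [h5]) (by omega) hbt <|
    .jumpEq_neg rfl (by cases b <;> simp) <|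
    .add (N + t) rfl (by simp [h2, h5]) (by omega) <|
    .load (N + t) t' rfl (by simp) (by omega) ht' <|
    .store (N + t) i rfl (by simp) (by omega) (by simp [h4]) <|
    .store (N + i) t rfl (by simp) (by omega) (by simp [h5]) <|
    .move t' rfl (by simp) <| .jump rfl <|
    .add (i + 1) rfl (by simp [h4, h3]) (by omega) <| .jump rfl <| .refl _, ?_⟩
  · norm_num
  · constructor <;> simp [*]

/-- Scanning a Dyck word leaves the stack as it was, because only the partner cells of that word are
written. The constant is 14 instructions for each of the two steps of an arch. -/
theorem reach_scan_word {N : ℕ} (hW : 2 * N ≤ W) (hS : 2 * N ≤ S) (b : Bool) (A : Forest) :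
    ∀ (i t : ℕ) (reg mem : ℕ → ℕ), ScanRegs reg N i t → i + 2 * A.size ≤ N →
      Stored mem i (A.word b) → (t = N ∨ t < N ∧ mem t = b.toNat) →
      ∃ n reg' mem', n ≤ 28 * A.size ∧ Reach program S W ⟨3, reg, mem⟩ n ⟨3, reg', mem'⟩ ∧
        ScanRegs reg' N (i + 2 * A.size) t ∧
        (∀ a, a < N + i ∨ N + i + 2 * A.size ≤ a → mem' a = mem a) ∧
        Matched (fun a => mem' (N + a)) i A := by
  induction A with
  | nil => exact fun i t reg mem hr _ _ _ =>
      ⟨0, reg, mem, by simp, .refl _, hr, fun _ _ => rfl, trivial⟩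
  | node B A ihB ihA =>
    intro i t reg mem hr hle hst ht
    simp only [Forest.size, Forest.word_node, stored_cons, stored_append,
      Forest.length_word] at hle hst ⊢
    obtain ⟨hi, hsB, hj, hsA⟩ := hst
    obtain ⟨n₁, reg₁, hn₁, hr₁, hreg₁⟩ := reach_push hr (by omega) hW hS hi ht
    have hmem₁ : ∀ a ≠ N + i, Function.update mem (N + i) t a = mem a :=
      fun a ha => Function.update_of_ne ha _ _
    obtain ⟨n₂, reg₂, mem₂, hn₂, hr₂, hreg₂, hmem₂, hmB⟩ := ihB (i + 1) i reg₁ _ hreg₁ (by omega)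
      (hsB.congr fun a h1 h2 => hmem₁ a (by simp at h2; omega))
      (.inr ⟨by omega, (hmem₁ i (by omega)).trans hi⟩)
    obtain ⟨n₃, reg₃, hn₃, hr₃, hreg₃⟩ := reach_pop (b := b) (mem := mem₂) hreg₂ (by omega) hW hS
      (by rw [hmem₂ _ (by omega), hmem₁ _ (by omega), hj]) (by omega)
      (by rw [hmem₂ _ (by omega), hmem₁ _ (by omega), hi])
      (t' := t) (by rw [hmem₂ _ (by omega), Function.update_self])
    have hmem₃ : ∀ a ≠ N + i, a ≠ N + (i + 1 + 2 * B.size) →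
        Function.update (Function.update mem₂ (N + i) (i + 1 + 2 * B.size))
          (N + (i + 1 + 2 * B.size)) i a = mem₂ a :=
      fun a h1 h2 => by rw [Function.update_of_ne h2, Function.update_of_ne h1]
    obtain ⟨n₄, reg₄, mem₄, hn₄, hr₄, hreg₄, hmem₄, hmA⟩ := ihA _ t reg₃
      (Function.update (Function.update mem₂ (N + i) (i + 1 + 2 * B.size))
        (N + (i + 1 + 2 * B.size)) i) hreg₃ (by omega)
      (hsA.congr fun a h1 h2 => by
        simp at h2
        rw [hmem₃ _ (by omega) (by omega), hmem₂ _ (by omega), hmem₁ _ (by omega)])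
      (ht.imp_right fun ⟨h1, h2⟩ => ⟨h1, by
        rw [hmem₃ _ (by omega) (by omega), hmem₂ _ (by omega), hmem₁ _ (by omega), h2]⟩)
    refine ⟨_, reg₄, mem₄, ?_, hr₁.trans (hr₂.trans (hr₃.trans hr₄)), ?_, ?_, ?_, ?_, ?_, ?_⟩
    · omega
    · convert hreg₄ using 1; omega
    · intro a ha
      rw [hmem₄ _ (by omega), hmem₃ _ (by omega) (by omega), hmem₂ _ (by omega),
        hmem₁ _ (by omega)]
    · simp only
      rw [hmem₄ _ (by omega), Function.update_of_ne (by omega), Function.update_self]; omega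
    · simp only
      rw [hmem₄ _ (by omega), show i + 2 * B.size + 1 = i + 1 + 2 * B.size by omega,
        Function.update_self]
    · exact hmB.congr fun a h1 h2 => by rw [hmem₄ _ (by omega), hmem₃ _ (by omega) (by omega)]
    · convert hmA using 1; omega

/-- The array `m` contains the matching of the steps of a sequence of arches starting at `o`. -/
def MatchedArches (m : ℕ → ℕ) : ℕ → List (Bool × Forest) → Prop
  | _, [] => True
  | o, s :: S => Matched m o (.node s.2 .nil) ∧ MatchedArches m (o + 2 * s.2.size + 2) S

@[simp] theorem arches_nil : arches [] = [] := rfl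

theorem arches_cons (s : Bool × Forest) (S : List (Bool × Forest)) :
    arches (s :: S) = (Forest.node s.2 .nil).word s.1 ++ arches S := by
  simp [arches]

theorem arches_append (S S' : List (Bool × Forest)) : arches (S ++ S') = arches S ++ arches S' := by
  simp [arches]

theorem matchedArches_append (m : ℕ → ℕ) (o : ℕ) (S S' : List (Bool × Forest)) :
    MatchedArches m o (S ++ S') ↔
      MatchedArches m o S ∧ MatchedArches m (o + (arches S).length) S' := by
  induction S generalizing o with
  | nil => simp [MatchedArches]
  | cons s S ih =>
    simp [MatchedArches, ih, and_assoc, arches_cons, add_assoc, add_comm 2]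

theorem MatchedArches.congr {m m' : ℕ → ℕ} {o : ℕ} {S : List (Bool × Forest)}
    (hm : MatchedArches m o S)
    (heq : ∀ a, o ≤ a → a < o + (arches S).length → m' a = m a) : MatchedArches m' o S := by
  induction S generalizing o with
  | nil => trivial
  | cons s S ih =>
    simp [arches_cons] at heq
    exact ⟨hm.1.congr fun a h1 h2 => heq a h1 (by simp [Forest.size] at h2; omega),
      ih hm.2 fun a h1 h2 => heq a (by omega) (by omega)⟩

theorem reach_scan_arches {N : ℕ} (hW : 2 * N ≤ W) (hS : 2 * N ≤ S) (s : List (Bool × Forest)) :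
    ∀ (i : ℕ) (reg mem : ℕ → ℕ), ScanRegs reg N i N → i + (arches s).length ≤ N →
      Stored mem i (arches s) →
      ∃ n reg' mem', n ≤ 14 * (arches s).length ∧
        Reach program S W ⟨3, reg, mem⟩ n ⟨3, reg', mem'⟩ ∧
        ScanRegs reg' N (i + (arches s).length) N ∧
        (∀ a, a < N + i ∨ N + i + (arches s).length ≤ a → mem' a = mem a) ∧
        MatchedArches (fun a => mem' (N + a)) i s := by
  induction s with
  | nil => exact fun i reg mem hr _ _ =>
      ⟨0, reg, mem, by simp, .refl _, hr, fun _ _ => rfl, trivial⟩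
  | cons s s' ih =>
    intro i reg mem hr hle hst
    rw [arches_cons] at hle hst ⊢
    rw [List.length_append, Forest.length_word] at hle ⊢
    obtain ⟨hs, hs'⟩ := (stored_append _ _ _ _).1 hst
    rw [Forest.length_word] at hs'
    obtain ⟨n₁, reg₁, mem₁, hn₁, hr₁, hreg₁, hmem₁, hm₁⟩ := reach_scan_word hW hS s.1
      (.node s.2 .nil) i N reg mem hr (by omega) hs (.inl rfl)
    obtain ⟨n₂, reg₂, mem₂, hn₂, hr₂, hreg₂, hmem₂, hm₂⟩ := ih _ reg₁ mem₁ hreg₁ (by omega)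
      (hs'.congr fun a h1 h2 => hmem₁ _ (by omega))
    refine ⟨_, reg₂, mem₂, by omega, hr₁.trans hr₂, ?_, fun a ha => ?_, ?_, ?_⟩
    · convert hreg₂ using 1; omega
    · rw [hmem₂ _ (by omega), hmem₁ _ (by omega)]
    · exact hm₁.congr fun a h1 h2 => hmem₂ _ (by omega)
    · exact hm₂

end ChungFeller

namespace ChungFeller

variable {S W : ℕ} {reg mem : ℕ → ℕ}

/-! ### The layout of the path -/

/-- The registers while the layout is computed; the arches between `i` and `j` are left. -/
structure LayoutRegs (reg : ℕ → ℕ) (N i j : ℕ) : Prop where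
  r2 : reg 2 = N
  r3 : reg 3 = 1
  r4 : reg 4 = j
  r9 : reg 9 = 0
  r10 : reg 10 = i

theorem reach_layout_neg {N i j p : ℕ} (hr : LayoutRegs reg N i j) (hij : i < j) (hj : j ≤ N)
    (hW : 2 * N ≤ W) (hS : 2 * N ≤ S) (hp : p < N) (hi : mem i = 0) (hm : mem (N + i) = p) :
    ∃ n reg', n ≤ 16 ∧ Reach program S W ⟨19, reg, mem⟩ n ⟨19, reg', mem⟩ ∧
      LayoutRegs reg' N (p + 1) j := by
  obtain ⟨h2, h3, h4, h9, h10⟩ := hr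
  refine ⟨_, _, ?_, .jumpEq_neg rfl (by omega) <| .load i 0 rfl h10 (by omega) hi <|
    .jumpEq_pos rfl (by simp [h9]) <| .add (N + i) rfl (by simp [h2, h10]) (by omega) <|
    .load (N + i) p rfl (by simp) (by omega) hm <| .add (p + 1) rfl (by simp [h3]) (by omega) <|
    .jump rfl <| .refl _, ?_⟩
  · norm_num
  · constructor <;> simp [*]

theorem reach_layout_pos {N i j q : ℕ} (hr : LayoutRegs reg N i (j + 1)) (hij : i ≤ j) (hj : j < N)
    (hW : 2 * N ≤ W) (hS : 2 * N ≤ S) (hi : mem i = 1) (hmj : mem j = 0)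
    (hm : mem (N + j) = q) :
    ∃ n reg', n ≤ 16 ∧ Reach program S W ⟨19, reg, mem⟩ n ⟨19, reg', mem⟩ ∧
      LayoutRegs reg' N i q := by
  obtain ⟨h2, h3, h4, h9, h10⟩ := hr
  refine ⟨_, _, ?_, .jumpEq_neg rfl (by omega) <| .load i 1 rfl h10 (by omega) hi <|
    .jumpEq_neg rfl (by simp [h9]) <| .sub j rfl (by simp [h3, h4]) <|
    .load j 0 rfl (by simp) (by omega) hmj <|
    .add (N + j) rfl (by simp [h2]) (by omega) <|
    .load (N + j) q rfl (by simp) (by omega) hm <| .jumpEq_pos rfl (by simp [h9]) <|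
    .move q rfl (by simp) <| .jump rfl <| .refl _, ?_⟩
  · norm_num
  · constructor <;> simp [*]

/-- The outer opening step `i` gets partner `j`, and the inner closing step `q` gets partner `p`.
The entries of `p` and `j` become stale, but `Layout.Partners` does not ask for them. -/
theorem reach_layout_cross {N i j p q : ℕ} (hr : LayoutRegs reg N i (j + 1)) (hij : i ≤ j)
    (hj : j < N) (hW : 2 * N ≤ W) (hS : 2 * N ≤ S) (hp : p < N) (hq : q < N) (hi : mem i = 1)
    (hmj : mem j = 1) (hm : mem (N + j) = q) (hm' : mem (N + i) = p) :
    ∃ n reg', n ≤ 16 ∧ Reach program S W ⟨19, reg, mem⟩ n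
      ⟨19, reg', Function.update (Function.update mem (N + i) j) (N + q) p⟩ ∧
      LayoutRegs reg' N (p + 1) q := by
  obtain ⟨h2, h3, h4, h9, h10⟩ := hr
  refine ⟨_, _, ?_, .jumpEq_neg rfl (by omega) <| .load i 1 rfl h10 (by omega) hi <|
    .jumpEq_neg rfl (by simp [h9]) <| .sub j rfl (by simp [h3, h4]) <|
    .load j 1 rfl (by simp) (by omega) hmj <|
    .add (N + j) rfl (by simp [h2]) (by omega) <|
    .load (N + j) q rfl (by simp) (by omega) hm <| .jumpEq_neg rfl (by simp [h9]) <|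
    .add (N + i) rfl (by simp [h2, h10]) (by omega) <|
    .load (N + i) p rfl (by simp) (by omega) hm' <|
    .store (N + i) j rfl (by simp) (by omega) (by simp) <|
    .add (N + q) rfl (by simp [h2]) (by omega) <|
    .store (N + q) p rfl (by simp) (by omega) (by simp) <|
    .add (p + 1) rfl (by simp [h3]) (by omega) <|
    .move q rfl (by simp) <| .jump rfl <| .refl _, ?_⟩
  · norm_num
  · constructor <;> simp [*]

theorem Layout.Partners.congr {m m' : ℕ → ℕ} {o : ℕ} {X : Layout} (hm : X.Partners m o)
    (heq : ∀ a, o ≤ a → a < o + 2 * X.toForest.size → m' a = m a) : X.Partners m' o := by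
  induction X generalizing o with
  | nil => trivial
  | neg K X ih =>
    simp only [Layout.toForest, Forest.size] at heq
    exact ih hm fun a h1 h2 => heq a (by omega) (by omega)
  | pos X Q ih =>
    simp only [Layout.toForest, Forest.size, Forest.size_append] at heq
    exact ⟨ih hm.1 fun a h1 h2 => heq a (by omega) (by omega),
      hm.2.congr fun a h1 h2 => heq a (by omega) (by simp only [Forest.size] at h2; omega)⟩
  | cross B X K ih =>
    simp only [Layout.toForest, Forest.size, Forest.size_append] at heq
    obtain ⟨h1, h2, h3, h4⟩ := hm
    exact ⟨h1.congr fun a h5 h6 => heq a (by omega) (by omega),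
      ih h2 fun a h5 h6 => heq a (by omega) (by omega),
      (heq _ (by omega) (by omega)).trans h3, (heq _ (by omega) (by omega)).trans h4⟩

/-- Each round removes one or two outermost arches, whence strong induction on their number. -/
theorem reach_layout {N : ℕ} (hW : 2 * N ≤ W) (hS : 2 * N ≤ S) (l : ℕ) :
    ∀ (s : List (Bool × Forest)), s.length = l → ∀ (i j : ℕ) (reg mem : ℕ → ℕ),
      LayoutRegs reg N i j → j = i + (arches s).length → j ≤ N → Stored mem i (arches s) →
      MatchedArches (fun a => mem (N + a)) i s →
      ∃ (n : ℕ) (reg' mem' : ℕ → ℕ) (X : Layout) (j' : ℕ), n ≤ 16 * l ∧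
        Reach program S W ⟨19, reg, mem⟩ n ⟨19, reg', mem'⟩ ∧
        LayoutRegs reg' N j' j' ∧ X.word = arches s ∧ j' = i + X.start ∧
        (∀ a, a < N + i ∨ N + j ≤ a → mem' a = mem a) ∧
        X.Partners (fun a => mem' (N + a)) i := by
  induction l using Nat.strong_induction_on with
  | _ l ih =>
  intro s hl i j reg mem hr hij hj hst hm
  rcases s with - | ⟨⟨b, A⟩, s⟩
  · obtain rfl : j = i := by simpa using hij
    exact ⟨0, reg, mem, .nil, j, by simp, .refl _, hr, rfl, by simp [Layout.start],
      fun _ _ => rfl, trivial⟩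
  rcases b with - | b
  · obtain ⟨hmA, hms⟩ := hm
    simp [arches_cons] at hij hst hl
    obtain ⟨hi, hsA, -, hss⟩ := hst
    obtain ⟨n₁, reg₁, hn₁, hr₁, hreg₁⟩ := reach_layout_neg (mem := mem)
      (p := i + 2 * A.size + 1) hr (by omega) hj hW hS (by omega) hi hmA.1
    obtain ⟨n₂, reg₂, mem₂, X, j', hn₂, hr₂, hreg₂, hX, hj', hmem₂, hp⟩ := ih s.length (by omega) s
      rfl _ j reg₁ mem hreg₁ (by omega) hj (by convert hss using 1; omega)
      (by convert hms using 1)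
    refine ⟨_, reg₂, mem₂, .neg A X, j', by omega, hr₁.trans hr₂, hreg₂, ?_, ?_, ?_, ?_⟩
    · simp [Layout.word, arches_cons, hX]
    · simp only [Layout.start]; omega
    · exact fun a ha => hmem₂ a (by omega)
    · exact hp
  · have hi : mem i = 1 := by
      simp [arches_cons] at hst
      exact hst.1
    -- The first arch is positive, so the sign of the last one decides between `pos` and `cross`.
    obtain h0 | ⟨s₁, ⟨b₁, Q⟩, hs⟩ := List.eq_nil_or_concat ((true, A) :: s)
    · simp at h0
    rw [List.concat_eq_append] at hs
    rw [hs, matchedArches_append] at hm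
    rw [hs, arches_append] at hst hij
    rw [hs, List.length_append, List.length_singleton] at hl
    rw [stored_append] at hst
    obtain ⟨hms₁, hmQ, -⟩ := hm
    obtain ⟨hst₁, hstQ⟩ := hst
    simp [arches_cons] at hij hstQ
    rcases b₁ with - | b₁
    · rcases s₁ with - | ⟨s₂, s₁⟩
      · simp at hs
      obtain ⟨rfl, rfl⟩ : (true, A) = s₂ ∧ s = s₁ ++ [(false, Q)] := by simpa using hs
      obtain ⟨hmA, hms₁⟩ := hms₁
      simp [arches_cons] at hst₁ hij hstQ hl hms₁ hmQ
      obtain ⟨-, hstA, -, hst₁⟩ := hst₁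
      obtain ⟨n₁, reg₁, hn₁, hr₁, hreg₁⟩ := reach_layout_cross (mem := mem)
        (j := i + 2 * A.size + (arches s₁).length + 2 * Q.size + 3)
        (p := i + 2 * A.size + 1) (q := i + 2 * A.size + 2 + (arches s₁).length)
        (by convert hr using 1; omega) (by omega) (by omega) hW hS (by omega) (by omega) hi
        ((congrArg mem (by omega)).trans hstQ.2.2)
        ((congrArg mem (by omega)).trans (hmQ.2.1.trans (by omega))) hmA.1
      have hmem₁ : ∀ a ≠ N + i, a ≠ N + (i + 2 * A.size + 2 + (arches s₁).length) →
          Function.update (Function.update mem (N + i)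
            (i + 2 * A.size + (arches s₁).length + 2 * Q.size + 3))
            (N + (i + 2 * A.size + 2 + (arches s₁).length)) (i + 2 * A.size + 1) a = mem a :=
        fun a h1 h2 => by rw [Function.update_of_ne h2, Function.update_of_ne h1]
      obtain ⟨n₂, reg₂, mem₂, X, j', hn₂, hr₂, hreg₂, hX, hj', hmem₂, hp⟩ := ih s₁.length
        (by omega) s₁ rfl _ _ reg₁ (Function.update (Function.update mem (N + i)
            (i + 2 * A.size + (arches s₁).length + 2 * Q.size + 3))
            (N + (i + 2 * A.size + 2 + (arches s₁).length)) (i + 2 * A.size + 1)) hreg₁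
        rfl (by omega)
        (by
          refine Stored.congr (mem := mem) (by convert hst₁ using 1; omega) fun a h1 h2 =>
            hmem₁ a (by omega) (by omega))
        (hms₁.congr fun a h1 h2 => hmem₁ _ (by omega) (by omega))
      have hlen : (arches s₁).length = 2 * X.toForest.size := by rw [← hX, Layout.length_word]
      refine ⟨_, reg₂, mem₂, .cross A X Q, j', by omega, hr₁.trans hr₂, hreg₂, ?_, ?_, ?_, ?_,
        hp, ?_, ?_⟩
      · simp [Layout.word, arches_cons, arches_append, hX]
      · simp only [Layout.start]; omega
      · exact fun a ha => by rw [hmem₂ a (by omega), hmem₁ a (by omega) (by omega)]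
      · have hmB : Matched (fun a => mem (N + a)) (i + 1) A := hmA.2.2.1
        exact hmB.congr fun a h1 h2 => by
          rw [hmem₂ _ (by omega), hmem₁ _ (by omega) (by omega)]
      · simp only
        rw [hmem₂ _ (by omega), Function.update_of_ne (by omega), Function.update_self]
        omega
      · simp only
        rw [show i + 2 * A.size + 2 * X.toForest.size + 2 =
          i + 2 * A.size + 2 + (arches s₁).length by omega, hmem₂ _ (by omega),
          Function.update_self]
    · obtain ⟨n₁, reg₁, hn₁, hr₁, hreg₁⟩ := reach_layout_pos (mem := mem)
        (j := i + (arches s₁).length + 2 * Q.size + 1)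
        (q := i + (arches s₁).length) (by convert hr using 1; omega) (by omega) (by omega) hW hS hi
        ((congrArg mem (by omega)).trans hstQ.2.2) hmQ.2.1
      obtain ⟨n₂, reg₂, mem₂, X, j', hn₂, hr₂, hreg₂, hX, hj', hmem₂, hp⟩ := ih s₁.length
        (by omega) s₁ rfl _ _ reg₁ mem hreg₁ rfl (by omega) hst₁ hms₁
      have hlen : (arches s₁).length = 2 * X.toForest.size := by rw [← hX, Layout.length_word]
      refine ⟨_, reg₂, mem₂, .pos X Q, j', by omega, hr₁.trans hr₂, hreg₂, ?_, ?_, ?_, hp, ?_⟩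
      · rw [hs]; simp [Layout.word, arches_cons, arches_append, hX]
      · simpa only [Layout.start] using hj'
      · exact fun a ha => hmem₂ a (by omega)
      · rw [← hlen]
        exact hmQ.congr fun a h1 h2 => hmem₂ _ (by omega)

/-! ### The computation of the paths -/

/-- The state of the machine between two half-steps, for the path `y` and the cursor `c`. -/
structure Ready (reg mem : ℕ → ℕ) (m : ℕ → ℕ) (y : List Bool) (c : ℕ) : Prop where
  r2 : reg 2 = y.length
  r3 : reg 3 = 1
  r9 : reg 9 = 0
  r10 : reg 10 = c
  stored : Stored mem 0 y
  partner : ∀ a, mem (y.length + a) = m a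

theorem Stored.update_set {y : List Bool} {p : ℕ} {b : Bool} (hs : Stored mem 0 y) :
    Stored (Function.update mem p b.toNat) 0 (y.set p b) := by
  rw [stored_iff_getElem?] at hs ⊢
  intro a b' hb
  rw [List.getElem?_set] at hb
  split_ifs at hb with h1 h2
  · obtain rfl : b = b' := by simpa using hb
    simp [h1]
  · rw [zero_add, Function.update_of_ne (Ne.symm h1)]
    simpa using hs a b' hb

theorem Ready.set {reg' m : ℕ → ℕ} {y : List Bool} {c c' p : ℕ} {b : Bool}
    (hr : Ready reg mem m y c) (hp : p < y.length) (h2 : reg' 2 = reg 2) (h3 : reg' 3 = reg 3)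
    (h9 : reg' 9 = reg 9) (h10 : reg' 10 = c') :
    Ready reg' (Function.update mem p b.toNat) m (y.set p b) c' where
  r2 := by rw [h2, hr.r2, List.length_set]
  r3 := h3.trans hr.r3
  r9 := h9.trans hr.r9
  r10 := h10
  stored := hr.stored.update_set
  partner a := by rw [List.length_set, Function.update_of_ne (by omega), hr.partner]

theorem Ready.mem_eq {m : ℕ → ℕ} {y : List Bool} {c a : ℕ} {b : Bool}
    (hr : Ready reg mem m y c) (hb : y[a]? = some b) : mem a = b.toNat := by
  simpa using (stored_iff_getElem? _ _ _).1 hr.stored a b hb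

/-- Both branches take equally many instructions, since the second ends with a jump to the very next
instruction. The same padding is used for `h`, which gives the loop a constant period. -/
theorem reach_g {m : ℕ → ℕ} {y z : List Bool} {c b v w : ℕ}
    (hs : HalfStep m ⟨false, y, c, v⟩ ⟨true, z, b, w⟩) (hr : Ready reg mem m y c)
    (hW : 2 * y.length ≤ W) (hS : 2 * y.length ≤ S) :
    ∃ reg' mem', Reach program S W ⟨39, reg, mem⟩ 8 ⟨49, reg', mem'⟩ ∧
      Ready reg' mem' m z b := by
  have h2 := hr.r2
  have h3 := hr.r3
  have h10 := hr.r10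
  cases hs with
  | @g _ _ _ p _ hc hp hc' hcy hsel hg =>
  rcases hsel with ⟨hyc, rfl⟩ | ⟨hyc, rfl⟩
  · refine ⟨_, _, .jumpEq_neg rfl (by omega) <|
      .add (y.length + c) rfl (by rw [h2, h10]) (by omega) <|
      .load (y.length + c) (m c) rfl (by simp) (by omega) (hr.partner c) <|
      .load c 1 rfl (by simp [h10]) (by omega) (hr.mem_eq hyc) <|
      .jumpEq_pos rfl (by simp [h3]) <|
      .store (m c) 1 rfl (by simp) (by omega) (by simp [h3]) <| .jump rfl <|
      .sub b rfl (by simp [h3]; omega) <| .refl _, ?_⟩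
    exact hr.set (b := true) hp (by simp) (by simp) (by simp) (by simp)
  · refine ⟨_, _, .jumpEq_neg rfl (by omega) <|
      .add (y.length + p) rfl (by rw [h2, h10]) (by omega) <|
      .load (y.length + p) (m p) rfl (by simp) (by omega) (hr.partner p) <|
      .load p 0 rfl (by simp [h10]) (by omega) (hr.mem_eq hyc) <|
      .jumpEq_neg rfl (by simp [h3]) <|
      .store p 1 rfl (by simp [h10]) (by omega) (by simp [h3]) <| .jump rfl <|
      .sub b rfl (by simp [h3]; omega) <| .refl _, ?_⟩
    exact hr.set (b := true) hp (by simp) (by simp) (by simp) (by simp)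

theorem reach_h {m : ℕ → ℕ} {y z : List Bool} {c b v w : ℕ}
    (hs : HalfStep m ⟨true, y, c, v⟩ ⟨false, z, b, w⟩) (hr : Ready reg mem m y c)
    (hW : 2 * y.length ≤ W) (hS : 2 * y.length ≤ S) :
    ∃ reg' mem', Reach program S W ⟨49, reg, mem⟩ 7 ⟨58, reg', mem'⟩ ∧
      Ready reg' mem' m z b := by
  have h2 := hr.r2
  have h3 := hr.r3
  have h9 := hr.r9
  have h10 := hr.r10
  cases hs with
  | @h _ _ _ p _ hc hp hc' hcy hsel hh =>
  rcases hsel with ⟨hyc, rfl⟩ | ⟨hyc, rfl⟩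
  · refine ⟨_, _, .add (y.length + c) rfl (by rw [h2, h10]) (by omega) <|
      .load (y.length + c) (m c) rfl (by simp) (by omega) (hr.partner c) <|
      .load c 0 rfl (by simp [h10]) (by omega) (hr.mem_eq hyc) <|
      .jumpEq_neg rfl (by simp [h3]) <|
      .store (m c) 0 rfl (by simp) (by omega) (by simp [h9]) <| .jump rfl <|
      .add b rfl (by simp [h3]; omega) (by omega) <| .refl _, ?_⟩
    exact hr.set (b := false) hp (by simp) (by simp) (by simp) (by simp)
  · refine ⟨_, _, .add (y.length + p) rfl (by rw [h2, h10]) (by omega) <|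
      .load (y.length + p) (m p) rfl (by simp) (by omega) (hr.partner p) <|
      .load p 1 rfl (by simp [h10]) (by omega) (hr.mem_eq hyc) <|
      .jumpEq_pos rfl (by simp [h3]) <|
      .store p 0 rfl (by simp [h10]) (by omega) (by simp [h9]) <| .jump rfl <|
      .add b rfl (by simp [h3]; omega) (by omega) <| .refl _, ?_⟩
    exact hr.set (b := false) hp (by simp) (by simp) (by simp) (by simp)

theorem HalfStep.length_eq {m : ℕ → ℕ} {s t : State} (hs : HalfStep m s t) :
    t.path.length = s.path.length := by
  cases hs <;> simp

/-- One iteration of the main loop. -/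
theorem run_fullStep {m : ℕ → ℕ} {y y' : List Bool} {v c c' : ℕ}
    (hs : FullStep m v y c y' c') (hr : Ready reg mem m y c)
    (hW : 2 * y.length ≤ W) (hS : 2 * y.length ≤ S) (hw : WordsAtMost W ⟨39, reg, mem⟩) :
    ∃ reg' mem', run program ⟨39, reg, mem⟩ 15 = ⟨58, reg', mem'⟩ ∧
      run program ⟨39, reg, mem⟩ 17 = ⟨39, reg', mem'⟩ ∧ Ready reg' mem' m y' c' ∧
      WordsAtMost W ⟨39, reg', mem'⟩ ∧
      ∀ t < 17, (AccessesBelow program S (run program ⟨39, reg, mem⟩ t) ∧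
        WordsAtMost W (run program ⟨39, reg, mem⟩ t)) ∧
        (Emits program (run program ⟨39, reg, mem⟩ t) ↔ t = 15) := by
  obtain ⟨z, b, hg, hh⟩ := hs
  obtain ⟨reg₁, mem₁, hr₁, hready₁⟩ := reach_g (S := S) (W := W) hg hr hW hS
  have hz : z.length = y.length := hg.length_eq
  obtain ⟨reg₂, mem₂, hr₂, hready₂⟩ := reach_h (S := S) (W := W) hh hready₁ (by omega)
    (by omega)
  obtain ⟨hrun, hw₂, ht⟩ := hr₁.trans hr₂ hw
  -- The two half-steps take 8 + 7 instructions; time 15 is the output and time 16 the jump back.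
  have h16 : run program ⟨39, reg, mem⟩ 16 = ⟨59, reg₂, mem₂⟩ := by
    rw [run_add _ 15 1, hrun]; rfl
  refine ⟨reg₂, mem₂, hrun, ?_, hready₂, hw₂, fun t ht17 => ?_⟩
  · rw [run_add _ 16 1, h16]; rfl
  · rcases Nat.lt_or_ge t 15 with hlt | hge
    · obtain ⟨h1, h2, h3⟩ := ht t hlt
      exact ⟨⟨h1, h2⟩, by simp only [h3, false_iff]; omega⟩
    · obtain rfl | rfl : t = 15 ∨ t = 16 := by omega
      · rw [hrun]
        exact ⟨⟨by rintro i hi a ha; obtain rfl : Instr.emit = i := by simpa [program] using hi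
                   simp [Instr.address] at ha, hw₂⟩, by simp [Emits, program]⟩
      · rw [h16]
        exact ⟨⟨by rintro i hi a ha; obtain rfl : Instr.jump 39 = i := by simpa [program] using hi
                   simp [Instr.address] at ha, hw₂⟩, by simp [Emits, program]⟩

theorem run_of_halted {P : Program} {c : Config} (hc : Halted P c) (t : ℕ) : run P c t = c := by
  refine Function.iterate_fixed ?_ t
  rw [step, List.getElem?_eq_none hc]

end ChungFeller

namespace ChungFeller

/-! ### Initialization, main loop and the complete execution -/

theorem stored_cells (x : List Bool) : Stored (cells x) 0 x := by
  rw [stored_iff_getElem?]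
  intro a b hb
  cases b <;> simp [cells, hb]

theorem Stored.eq_cells {mem : ℕ → ℕ} {x : List Bool} (hs : Stored mem 0 x) {a : ℕ}
    (ha : a < x.length) : mem a = cells x a := by
  have h0 := (stored_iff_getElem? _ _ _).1 hs a x[a] (by simp [ha])
  rw [zero_add] at h0
  rw [h0]
  cases hb : x[a] <;> simp [cells, ha, hb]

/-- The initialization. -/
theorem reach_init {k e W S : ℕ} {x : List Bool} (hk : 1 ≤ k) (hx : x ∈ D k e) (hW : 4 * k ≤ W)
    (hS : 4 * k ≤ S) :
    ∃ (n : ℕ) (reg mem : ℕ → ℕ) (m : ℕ → ℕ) (c : ℕ), 3 ≤ n ∧ n ≤ 64 * k ∧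
      Reach program S W (input k e x) n ⟨39, reg, mem⟩ ∧ Ready reg mem m x c ∧
      FullWalk m x c e (2 * k) k := by
  obtain ⟨hlen, hcount, hflaws⟩ := hx
  obtain ⟨s, rfl⟩ := exists_arches x (by have := ht_add_length x; omega)
  have hinit : ∃ reg, Reach program S W (input k e (arches s)) 3 ⟨3, reg, cells (arches s)⟩ ∧
      ScanRegs reg (2 * k) 0 (2 * k) := by
    refine ⟨_, .const rfl (by omega) <| .add (2 * k) rfl (by simp; omega) (by omega) <|
      .move (2 * k) rfl (by simp) <| .refl _, ?_⟩
    constructor <;> simp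
  obtain ⟨reg₁, hr₁, hreg₁⟩ := hinit
  obtain ⟨n₂, reg₂, mem₂, hn₂, hr₂, hreg₂, hmem₂, hm₂⟩ := reach_scan_arches (N := 2 * k) (W := W)
    (S := S) (by omega) (by omega) s 0 reg₁ _ hreg₁ (by omega) (stored_cells _)
  rw [hlen, zero_add] at hreg₂
  have hr₃ : Reach program S W ⟨3, reg₂, mem₂⟩ 1 ⟨19, reg₂, mem₂⟩ :=
    .jumpEq_pos rfl (by rw [hreg₂.r4, hreg₂.r2]) (.refl _)
  have hst₂ : Stored mem₂ 0 (arches s) :=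
    (stored_cells _).congr fun a _ h => hmem₂ a (by omega)
  obtain ⟨n₄, reg₄, mem₄, X, c, hn₄, hr₄, hreg₄, hX, hc, hmem₄, hm₄⟩ := reach_layout (N := 2 * k)
    (W := W) (S := S) (by omega) (by omega) s.length s rfl 0 (2 * k) reg₂ mem₂
    ⟨hreg₂.r2, hreg₂.r3, hreg₂.r4, hreg₂.r9, hreg₂.r10⟩ (by omega) le_rfl hst₂ hm₂
  have hr₅ : Reach program S W ⟨19, reg₄, mem₄⟩ 1 ⟨39, reg₄, mem₄⟩ :=
    .jumpEq_pos rfl (by rw [hreg₄.r4, hreg₄.r10]) (.refl _)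
  -- An arch has at least two steps, so there are at most `k` arches.
  have hs : 2 * s.length ≤ (arches s).length := by
    clear * -
    induction s with
    | nil => simp
    | cons a s ih => simp [arches_cons]; omega
  -- The time is at most 3 + 28k + 1 + 16k + 1, which is below 64k as `k` is positive.
  refine ⟨_, reg₄, mem₄, fun a => mem₄ (2 * k + a), c, ?_, ?_,
    hr₁.trans (hr₂.trans (hr₃.trans (hr₄.trans hr₅))), ?_, ?_⟩
  · omega
  · omega
  · exact ⟨by rw [hreg₄.r2, hlen], hreg₄.r3, hreg₄.r9, hreg₄.r10,
      hst₂.congr fun a _ h => hmem₄ a (by omega), fun a => by rw [hlen]⟩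
  · have hw := fullWalk_layout X hm₄
    have hsize : 2 * X.toForest.size = 2 * k := by rw [← X.length_word, hX, hlen]
    obtain rfl : X.toForest.size = k := by omega
    rw [zero_add] at hc
    rwa [hX, hflaws, ← hc] at hw

/-- The main loop. -/
theorem run_loop {S W e k T₀ n : ℕ} {c₀ : Config} {reg mem m cur : ℕ → ℕ} {x : List Bool}
    (hx : x ∈ D k e) (hW : 4 * k ≤ W) (hS : 4 * k ≤ S)
    (hrun : run program c₀ T₀ = ⟨39, reg, mem⟩) (hw : WordsAtMost W ⟨39, reg, mem⟩)
    (hr : Ready reg mem m x (cur 0))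
    (hs : ∀ i < n, FullStep m (e + i) (f^[i] x) (cur i) (f^[i + 1] x) (cur (i + 1))) :
    ∀ i ≤ n, f^[i] x ∈ D k (e + i) ∧ ∃ reg mem, run program c₀ (T₀ + 17 * i) = ⟨39, reg, mem⟩ ∧
      WordsAtMost W ⟨39, reg, mem⟩ ∧ Ready reg mem m (f^[i] x) (cur i) ∧
      (∀ j, i = j + 1 → ∃ reg', run program c₀ (T₀ + 17 * j + 15) = ⟨58, reg', mem⟩) ∧
      (i < n → ∀ t < 17, (AccessesBelow program S (run program c₀ (T₀ + 17 * i + t)) ∧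
        WordsAtMost W (run program c₀ (T₀ + 17 * i + t))) ∧
        (Emits program (run program c₀ (T₀ + 17 * i + t)) ↔ t = 15)) := by
  intro i
  induction i with
  | zero =>
    refine fun _ => ⟨hx, reg, mem, hrun, hw, hr, by simp, fun hn => ?_⟩
    obtain ⟨_, _, -, -, -, -, ht⟩ := run_fullStep (S := S) (hs 0 hn) hr (by
      rw [Function.iterate_zero, id, hx.1]; omega) (by
      rw [Function.iterate_zero, id, hx.1]; omega) hw
    simpa only [run_add, mul_zero, add_zero, hrun] using ht
  | succ i ih =>
    intro hi
    obtain ⟨hD, reg, mem, hrun, hw, hr, -, -⟩ := ih (by omega)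
    have hlen : (f^[i] x).length = 2 * k := hD.1
    have hD' := (hs i (by omega)).mem_D hlen
    obtain ⟨reg', mem', h15, h17, hr', hw', -⟩ := run_fullStep (S := S) (hs i (by omega)) hr
      (by omega) (by omega) hw
    have hrun' : run program c₀ (T₀ + 17 * (i + 1)) = ⟨39, reg', mem'⟩ := by
      rw [mul_add, ← add_assoc, mul_one, run_add, hrun, h17]
    refine ⟨hD', reg', mem', hrun', hw', hr', fun j hj => ?_, fun hn => ?_⟩
    -- Neither the output nor the jump changes memory, so the memory at the output is that of the
    -- next round.
    · obtain rfl : i = j := by omega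
      exact ⟨reg', by rw [run_add, hrun, h15]⟩
    · have hlen' : (f^[i + 1] x).length = 2 * k := hD'.1
      obtain ⟨_, _, -, -, -, -, ht⟩ := run_fullStep (S := S) (hs (i + 1) hn) hr'
        (by omega) (by omega) hw'
      simpa only [run_add _ (T₀ + 17 * (i + 1)), hrun'] using ht

end ChungFeller

/-- One program `P` and one constant `C` serve all inputs. Here `τ 0` is the time at which the
initialization ends, `τ 1, …, τ (k - e)` are the times at which the machine outputs a path, the
`i`-th output is `f^i(x)`, and `T` is the total running time. -/
theorem theorem3 :
    ∃ (P : ChungFeller.Program) (C : ℕ), ∀ (k e : ℕ) (x : List Bool),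
      1 ≤ k → e < k → x ∈ ChungFeller.D k e →
      ∃ (τ : ℕ → ℕ) (T : ℕ),
        -- the initialization takes time `O(k)`
        τ 0 ≤ C * k ∧
        -- each further path takes time `O(1)`
        (∀ i < k - e, τ i < τ (i + 1) ∧ τ (i + 1) ≤ τ i + C) ∧
        -- outputs occur at the times `τ 1, …, τ (k - e)` and at no other time
        (∀ t, ChungFeller.Emits P (ChungFeller.run P (ChungFeller.input k e x) t) ↔
          ∃ i, 1 ≤ i ∧ i ≤ k - e ∧ t = τ i) ∧
        -- the `i`-th output is the Dyck path `f^i(x)`, with `e + i` flaws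
        (∀ i, 1 ≤ i → i ≤ k - e →
          ChungFeller.f^[i] x ∈ ChungFeller.D k (e + i) ∧
          ∀ a < 2 * k, (ChungFeller.run P (ChungFeller.input k e x) (τ i)).mem a =
            ChungFeller.cells (ChungFeller.f^[i] x) a) ∧
        -- the machine halts after a total time of `O(k)`, in time `O(1)` after the last output
        ChungFeller.Halted P (ChungFeller.run P (ChungFeller.input k e x) T) ∧
        T ≤ C * k ∧ T ≤ τ (k - e) + C ∧
        -- it uses space `O(k)`, with words of `log k + O(1)` bits
        (∀ t, ChungFeller.AccessesBelow P (C * k)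
            (ChungFeller.run P (ChungFeller.input k e x) t) ∧
          ChungFeller.WordsAtMost (C * k)
            (ChungFeller.run P (ChungFeller.input k e x) t)) := by
  -- The total time is at most 64k + 17k + 1, and addresses and words need only 4k.
  refine ⟨ChungFeller.program, 100, fun k e x hk he hx => ?_⟩
  obtain ⟨T₀, reg, mem, m, c, hT, hT', hreach, hready, n, cur, rfl, hcn, hn, hsteps⟩ :=
    ChungFeller.reach_init (W := 100 * k) (S := 100 * k) hk hx (by omega) (by omega)
  obtain rfl : n = k - e := by omega
  obtain ⟨hrun, hw, hpre⟩ := hreach ⟨fun r => by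
    simp only [ChungFeller.input]; split_ifs <;> omega, fun a => by
    simp only [ChungFeller.input, ChungFeller.cells]; split_ifs <;> omega⟩
  have hloop := ChungFeller.run_loop (S := 100 * k) hx (by omega) (by omega) hrun hw hready hsteps
  obtain ⟨hDn, regn, memn, hrunn, hwn, hrn, -, -⟩ := hloop (k - e) le_rfl
  -- The cursor has reached the end `2k` of the path, so the first test of the loop exits.
  have hlast : ChungFeller.Reach ChungFeller.program (100 * k) (100 * k) ⟨39, regn, memn⟩ 1
      ⟨60, regn, memn⟩ := .jumpEq_pos rfl (by rw [hrn.r2, hrn.r10, hcn, hDn.1]) (.refl _)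
  obtain ⟨hrunT, hwT, htT⟩ := hlast hwn
  have hhalt : ChungFeller.Halted ChungFeller.program ⟨60, regn, memn⟩ := le_rfl
  have hend : ∀ t, ChungFeller.run ChungFeller.program (ChungFeller.input k e x)
      (T₀ + 17 * (k - e) + 1 + t) = ⟨60, regn, memn⟩ := fun t => by
    rw [ChungFeller.run_add, ChungFeller.run_add, hrunn, hrunT, ChungFeller.run_of_halted hhalt]
  -- the four parts of the execution
  have hcases : ∀ t, t < T₀ ∨ (∃ i < k - e, ∃ j < 17, t = T₀ + 17 * i + j) ∨
      t = T₀ + 17 * (k - e) ∨ ∃ j, t = T₀ + 17 * (k - e) + 1 + j := fun t => by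
    by_cases h1 : t < T₀
    · exact .inl h1
    by_cases h2 : t < T₀ + 17 * (k - e)
    · exact .inr (.inl ⟨(t - T₀) / 17, by omega, (t - T₀) % 17, by omega, by omega⟩)
    by_cases h3 : t = T₀ + 17 * (k - e)
    · exact .inr (.inr (.inl h3))
    · exact .inr (.inr (.inr ⟨t - (T₀ + 17 * (k - e) + 1), by omega⟩))
  -- Round `i` outputs at `T₀ + 17 * (i - 1) + 15`. Since `3 ≤ T₀`, the subtraction is not truncated
  -- even at `i = 0`.
  obtain ⟨τ, hτ⟩ : ∃ τ : ℕ → ℕ, ∀ i, τ i = T₀ + 17 * i - 2 := ⟨_, fun _ => rfl⟩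
  refine ⟨τ, T₀ + 17 * (k - e) + 1, by rw [hτ]; omega, fun i _ => by rw [hτ, hτ]; omega,
    fun t => ?_, fun i hi1 hik => ?_, ?_, by omega, by rw [hτ]; omega, fun t => ?_⟩
  · rcases hcases t with ht | ⟨i, hi, j, hj, rfl⟩ | rfl | ⟨j, rfl⟩
    · exact iff_of_false (hpre t ht).2.2 (by rintro ⟨i, h1, -, h2⟩; rw [hτ] at h2; omega)
    · rw [((hloop i hi.le).2.choose_spec.choose_spec.2.2.2.2 hi j hj).2]
      exact ⟨fun h => ⟨i + 1, by omega, by omega, by rw [hτ]; omega⟩,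
        by rintro ⟨i', h1, h2, h3⟩; rw [hτ] at h3; omega⟩
    · rw [hrunn]
      exact iff_of_false (htT 0 one_pos).2.2 (by rintro ⟨i, h1, h2, h3⟩; rw [hτ] at h3; omega)
    · rw [hend]
      exact iff_of_false (by simp [ChungFeller.Emits, ChungFeller.program])
        (by rintro ⟨i, h1, h2, h3⟩; rw [hτ] at h3; omega)
  · obtain ⟨hD, reg', mem', -, -, hr, hemit, -⟩ := hloop i hik
    obtain ⟨j, rfl⟩ : ∃ j, i = j + 1 := ⟨i - 1, by omega⟩
    obtain ⟨reg'', hrun'⟩ := hemit j rfl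
    refine ⟨hD, fun a ha => ?_⟩
    rw [hτ, show T₀ + 17 * (j + 1) - 2 = T₀ + 17 * j + 15 by omega, hrun']
    exact hr.stored.eq_cells (by rw [hD.1]; exact ha)
  · have := hend 0
    rw [add_zero] at this
    rw [this]
    exact hhalt
  · rcases hcases t with ht | ⟨i, hi, j, hj, rfl⟩ | rfl | ⟨j, rfl⟩
    · exact ⟨(hpre t ht).1, (hpre t ht).2.1⟩
    · exact ((hloop i hi.le).2.choose_spec.choose_spec.2.2.2.2 hi j hj).1
    · rw [hrunn]
      exact ⟨(htT 0 one_pos).1, hwn⟩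
    · rw [hend]
      exact ⟨by simp [ChungFeller.AccessesBelow, ChungFeller.program], hwT⟩
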